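/- Let $F(a,b;c;\cdot)$ be the Gauss hypergeometric function (power series at $0$, continued analytically to $\mathbb C\setminus[1,\infty)$; complex parameters, third parameter not in $\mathbb Z_{\le 0}$), and put, on the real line, \begin{align*} w_1(x;a,b,c)&=F(a,b;c;x)\ (x<1), & w_2&=|x|^{1-c}F(a-c+1,b-c+1;2-c;x)\ (0\ne x<1),\\ w_3&=|x|^{-a}F(a,a-c+1;a-b+1;x^{-1})\ (x<0\text{ or }x>1), & w_4&=|x|^{-b}F(b,b-c+1;b-a+1;x^{-1})\ (x<0\text{ or }x>1),\\ w_5&=F(a,b;a+b-c+1;1-x)\ (x>0), & w_6&=|1-x|^{c-a-b}F(c-a,c-b;c-a-b+1;1-x)\ (x>0,\ x\neq1). \end{align*} Assume throughout that the third parameters of the hypergeometric series on both sides of each formula are not in $\mathbb Z_{\le0}$. All integrals below converge absolutely. A right-hand side with a removable singularity at $x$ is read as its limit there. **(A) Type $c+$.** For each $i$ one has $$\int_{I_i(x)}|y|^{c-1}w_i(y;a,b,c)\frac{|x-y|^{\mu-1}}{\Gamma(\mu)}\,dy=K_i\,|x|^{c+\mu-1}w_i(x;a,b,c+\mu)\qquad(\Re\mu>0)$$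 with - $i=1$: $I=\{0<y/x<1\}$, $K=\frac{\Gamma(c)}{\Gamma(c+\mu)}$, for $0\neq x<1$, $\Re c>0$; - $i=2$: $I=(-\infty,x)$, $K=\frac{\Gamma(a-c-\mu+1)}{\Gamma(a-c+1)}\frac{\Gamma(b-c-\mu+1)}{\Gamma(b-c+1)}\frac{\Gamma(2-c)}{\Gamma(2-c-\mu)}$, for $x<1$, $\Re(a-c+1),\Re(b-c+1)>\Re\mu$; - $i=3$: $I=\{y/x>1\}$, $K=\frac{\Gamma(a-c-\mu+1)}{\Gamma(a-c+1)}$, for $x<0$ or $x>1$, $\Re(a-c+1)>\Re\mu$; - $i=4$: $I=\{y/x>1\}$, $K=\frac{\Gamma(b-c-\mu+1)}{\Gamma(b-c+1)}$, for $x<0$ or $x>1$, $\Re(b-c+1)>\Re\mu$; - $i=5$: $I=(x,\infty)$, $K=\frac{\Gamma(b-c-\mu+1)}{\Gamma(b-c+1)}\frac{\Gamma(a-c-\mu+1)}{\Gamma(a-c+1)}\frac{\Gamma(a+b-c+1)}{\Gamma(a+b-c-\mu+1)}$, for $x>0$, $\Re(a-c+1),\Re(b-c+1)>\Re\mu$;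 - $i=6$: $I=\{0<\frac{1-y}{1-x}<1\}$, $K=\frac{\Gamma(c-a-b+1)}{\Gamma(c-a-b+\mu+1)}$, for $x>0$, $x\ne1$, $\Re(c-a-b+1)>0$. **(B) Three further formulas** (with $\Re\mu>0$): $$\int_{0<y/x<1}|y|^{a-\mu-1}w_2(y;a,b,c)\tfrac{|x-y|^{\mu-1}}{\Gamma(\mu)}dy=\tfrac{\Gamma(a-c-\mu+1)}{\Gamma(a-c+1)}|x|^{a-1}w_2(x;a-\mu,b,c)\quad(0\ne x<1,\ \Re(a-c+1)>\Re\mu),$$ $$\int_{y/x>1}w_4(y;a,b,c)\tfrac{|x-y|^{\mu-1}}{\Gamma(\mu)}dy=\tfrac{\Gamma(b-\mu)}{\Gamma(b)}w_4(x;a-\mu,b-\mu,c-\mu)\quad(x<0\text{ or }x>1,\ \Re b>\Re\mu),$$ $$\int_{0<\frac{1-y}{1-x}<1}w_6(y;a,b,c)\tfrac{|x-y|^{\mu-1}}{\Gamma(\mu)}dy=\tfrac{\Gamma(c-a-b+1)}{\Gamma(c-a-b+\mu+1)}w_6(x;a-\mu,b-\mu,c-\mu)\quad(x>0,\ x\ne1,\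 \Re(c-a-b+1)>0).$$ **(C) All eight types, all six solutions.** The type $T$ determines target parameters $(a',b',c')$ and weights $w(y)$, $v(x)$. For $w_1$ it also determines a constant $K_T(a,b,c;\mu)$, conditions (always including $\Re\mu>0$), an integration set $I_T(x)$ and a range $J_T$ of $x$. Write $|y|,|1-y|$ for absolute values of real numbers. | $T$ | $(a',b',c')$ | $w(y)$ | $v(x)$ | $K_T$ | conditions | |---|---|---|---|---|---| | $c+$ | $(a,b,c+\mu)$ | $\lvert y\rvert^{c-1}$ | $\lvert x\rvert^{c+\mu-1}$ | $\Gamma(c)/\Gamma(c+\mu)$ | $\Re c>0$ | | $a+,c+$ | $(a+\mu,b,c+\mu)$ | $\lvert y\rvert^{c-1}\lvert1-y\rvert^{b-c-\mu}$ | $\lvert x\rvert^{c+\mu-1}\lvert1-x\rvert^{b-c}$ | $\Gamma(c)/\Gamma(c+\mu)$ | $\Re c>0$ | | $a+,b+,c+$ | $(a+\mu,b+\mu,c+\mu)$ | $\lvert y\rvert^{c-1}\lvert1-y\rvert^{a+b-c}$ | $\lvert x\rvert^{c+\mu-1}\lvert1-x\rvert^{a+b-c+\mu}$ | $\Gamma(c)/\Gamma(c+\mu)$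 | $\Re c>0$ | | $a-$ | $(a-\mu,b,c)$ | $\lvert y\rvert^{a-\mu-1}$ | $\lvert x\rvert^{a-1}$ | $\Gamma(a-\mu)/\Gamma(a)$ | $\Re a>\Re\mu$ | | $a+$ | $(a+\mu,b,c)$ | $\lvert y\rvert^{c-a-\mu-1}\lvert1-y\rvert^{a+b-c}$ | $\lvert x\rvert^{c-a-1}\lvert1-x\rvert^{a+b-c+\mu}$ | $\Gamma(c-a-\mu)/\Gamma(c-a)$ | $\Re(c-a)>\Re\mu$ | | $a-,b-,c-$ | $(a-\mu,b-\mu,c-\mu)$ | $1$ | $1$ | $\frac{\Gamma(a-\mu)\Gamma(b-\mu)\Gamma(c)}{\Gamma(a)\Gamma(b)\Gamma(c-\mu)}$ | $\Re a,\Re b>\Re\mu$ | | $a-,c-$ | $(a-\mu,b,c-\mu)$ | $\lvert1-y\rvert^{a-\mu-1}$ | $\lvert1-x\rvert^{a-1}$ | $\frac{\Gamma(a-\mu)\Gamma(c-b-\mu)\Gamma(c)}{\Gamma(a)\Gamma(c-b)\Gamma(c-\mu)}$ | $\Re a,\Re(c-b)>\Re\mu$ | | $c-$ | $(a,b,c-\mu)$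 | $\lvert1-y\rvert^{a+b-c}$ | $\lvert1-x\rvert^{a+b-c+\mu}$ | $\frac{\Gamma(c-a-\mu)\Gamma(c-b-\mu)\Gamma(c)}{\Gamma(c-a)\Gamma(c-b)\Gamma(c-\mu)}$ | $\Re(c-a),\Re(c-b)>\Re\mu$ | For the first five types $I_T(x)=\{0<y/x<1\}$ and $J_T=\{0\ne x<1\}$; for the last three $J_T=(-\infty,1)$, with $I_T(x)=(-\infty,x)$ for $a-,b-,c-$ and $c-$, and $I_T(x)=(x,1)$ for $a-,c-$. For every type $T$ and every $j\in\{1,\dots,6\}$, let $T'=T'(T,j)$ be the entry of the following table in the row of $T$ (the $w_1$ column names $T$): | $w_1$ | $w_2$ | $w_3$ | $w_4$ | $w_5$ | $w_6$ | |---|---|---|---|---|---| | $c+$ | $a-,b-,c-$ | $a-$ | $a-$ | $c-$ | $a+,b+,c+$ | | $a+,c+$ | $a-,c-$ | $a+,c+$ | $a-,c-$ | $a+$ | $a+$ | | $a+,b+,c+$ | $c-$ | $a+$ | $a+$ | $a+,b+,c+$ | $c-$ | | $a-$ | $a-$ | $a-,b-,c-$ | $c+$ | $a-,c-$ | $a+,c+$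 | | $a+$ | $a+$ | $a+,b+,c+$ | $c-$ | $a+,c+$ | $a-,c-$ | | $a-,b-,c-$ | $c+$ | $a-$ | $a-$ | $a-,b-,c-$ | $c+$ | | $a-,c-$ | $a+,c+$ | $a-,c-$ | $a+,c+$ | $a-$ | $a-$ | | $c-$ | $a+,b+,c+$ | $a+$ | $a+$ | $c+$ | $a-,b-,c-$ | Let $\varphi_j(x)$ be the argument $x$, $1/x$ or $1-x$ of the hypergeometric function in $w_j$, and let $(\alpha,\beta,\gamma)$ be its parameters, with the two upper parameters taken in the order in which they appear in the definition of $w_j$ above, except that they are interchanged when $j=2$ and $T$ is $a+,c+$ or $a-,c-$; when $j=3$ and $T$ is $c+$ or $c-$; when $j=4$ and $T$ is $c+$, $c-$, $a+,c+$ or $a-,c-$; and when $j=6$ and $T$ is $a+,c+$ or $a-,c-$. Then, under the conditions of type $T'$ at $(\alpha,\beta,\gamma)$, $$\int_{\varphi_j(y)\in I_{T'}(\varphi_j(x))}w(y)\,w_j(y;a,b,c)\frac{|x-y|^{\mu-1}}{\Gamma(\mu)}\,dy=K_{T'}(\alpha,\beta,\gamma;\mu)\,v(x)\,w_j(x;a',b',c')\qquad(\varphi_j(x)\in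 J_{T'}),$$ where $w,v,a',b',c'$ are those of type $T$ at $(a,b,c)$, and where $x,y\neq0$ if $j=3,4$. Moreover this formula reduces to the $w_1$-formula of type $T'$ at $(\alpha,\beta,\gamma)$ by the substitution $t=\varphi_j(y)$: replacing $(a,b,c)$ by $(a',b',c')$ replaces $(\alpha,\beta,\gamma)$ by its type-$T'$ target parameters, and, with $A(x)=|x|^{\mu-1}$ for $j=3,4$ and $A(x)=1$ otherwise, for all real $x,y\notin\{0,1\}$ the function $w(y)w_j(y;a,b,c)|x-y|^{\mu-1}$ equals $A(x)|\varphi_j'(y)|$ times the corresponding function for $w_1$ and type $T'$ at $(\varphi_j(x),\varphi_j(y))$, and $v(x)w_j(x;a',b',c')$ equals $A(x)$ times the corresponding function for $w_1$ and type $T'$ at $\varphi_j(x)$. -/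

import Mathlib

open MeasureTheory Filter Topology

namespace FracHyp

noncomputable section

/-! ## The Gauss hypergeometric function on the plane cut along `[1, ∞)` -/

/-- The cut `[1, ∞)` of the complex plane. -/
def cut : Set ℂ := {z | z.im = 0 ∧ 1 ≤ z.re}

/-- `v` is the value at `z` of the analytic continuation, inside `ℂ ∖ [1, ∞)`, of the power series
`∑ (a)ₖ (b)ₖ / ((c)ₖ k!) zᵏ`. The continuation lives on some open set `U` that is star-shaped with
respect to `0` and contains `z`; by the identity theorem `v` does not depend on the choice of `U`
and `f`. (The whole domain `ℂ ∖ [1, ∞)` is itself such a set `U`.) -/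
def IsGaussValue (a b c z v : ℂ) : Prop :=
  ∃ (U : Set ℂ) (f : ℂ → ℂ), IsOpen U ∧ StarConvex ℝ 0 U ∧ 0 ∈ U ∧ z ∈ U ∧ Disjoint U cut ∧
    AnalyticOnNhd ℂ f U ∧ (∀ᶠ t in 𝓝 (0 : ℂ), f t = ordinaryHypergeometric a b c t) ∧ f z = v

theorem IsGaussValue.unique {a b c z v v' : ℂ} (h : IsGaussValue a b c z v)
    (h' : IsGaussValue a b c z v') : v = v' := by
  obtain ⟨U, f, hU, sU, zU, hzU, -, aU, eU, rfl⟩ := h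
  obtain ⟨V, g, hV, sV, zV, hzV, -, aV, eV, rfl⟩ := h'
  have hs : StarConvex ℝ 0 (U ∩ V) := sU.inter sV
  have hc : IsPreconnected (U ∩ V) := (StarConvex.isPathConnected hs ⟨zU, zV⟩).isConnected.isPreconnected
  have he : f =ᶠ[𝓝 0] g := by filter_upwards [eU, eV] with t h1 h2 using h1.trans h2.symm
  exact (aU.mono Set.inter_subset_left).eqOn_of_preconnected_of_eventuallyEq
    (aV.mono Set.inter_subset_right) hc ⟨zU, zV⟩ he ⟨hzU, hzV⟩

open Classical in
/-- The Gauss hypergeometric function `F(a, b; c; z)` for `z ∉ [1, ∞)`. -/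
def gaussF (a b c z : ℂ) : ℂ :=
  if h : ∃ v, IsGaussValue a b c z v then h.choose else 0

/-- `z` is not in `{0, -1, -2, …}`. -/
def NotPole (z : ℂ) : Prop := ∀ n : ℕ, z ≠ -(n : ℂ)

/-- `|x|^s` for real `x` and complex `s` (principal value). -/
def absPow (x : ℝ) (s : ℂ) : ℂ := ((|x| : ℝ) : ℂ) ^ s

/-! ## The six solutions on the real line -/

/-- `F(a, b; c; x)`, for `x < 1`. -/
def w₁ (x : ℝ) (a b c : ℂ) : ℂ := gaussF a b c (x : ℂ)

/-- `|x|^(1-c) F(a-c+1, b-c+1; 2-c; x)`, for `x < 0` or `0 < x < 1`. -/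
def w₂ (x : ℝ) (a b c : ℂ) : ℂ :=
  absPow x (1 - c) * gaussF (a - c + 1) (b - c + 1) (2 - c) (x : ℂ)

/-- `|x|^(-a) F(a, a-c+1; a-b+1; 1/x)`, for `x < 0` or `1 < x`. -/
def w₃ (x : ℝ) (a b c : ℂ) : ℂ :=
  absPow x (-a) * gaussF a (a - c + 1) (a - b + 1) ((x⁻¹ : ℝ) : ℂ)

/-- `|x|^(-b) F(b, b-c+1; b-a+1; 1/x)`, for `x < 0` or `1 < x`. -/
def w₄ (x : ℝ) (a b c : ℂ) : ℂ :=
  absPow x (-b) * gaussF b (b - c + 1) (b - a + 1) ((x⁻¹ : ℝ) : ℂ)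

/-- `F(a, b; a+b-c+1; 1-x)`, for `0 < x`. -/
def w₅ (x : ℝ) (a b c : ℂ) : ℂ := gaussF a b (a + b - c + 1) ((1 - x : ℝ) : ℂ)

/-- `|1-x|^(c-a-b) F(c-a, c-b; c-a-b+1; 1-x)`, for `0 < x < 1` or `1 < x`. -/
def w₆ (x : ℝ) (a b c : ℂ) : ℂ :=
  absPow (1 - x) (c - a - b) * gaussF (c - a) (c - b) (c - a - b + 1) ((1 - x : ℝ) : ℂ)

/-! ## Fractional integrals -/

/-- The fractional integral `∫_I g(y) |x-y|^(μ-1) / Γ(μ) dy` converges absolutely and equals `R`. -/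
def HasFracInt (I : Set ℝ) (g : ℝ → ℂ) (μ : ℂ) (x : ℝ) (R : ℂ) : Prop :=
  IntegrableOn (fun y => g y * (absPow (x - y) (μ - 1) / Complex.Gamma μ)) I ∧
    ∫ y in I, g y * (absPow (x - y) (μ - 1) / Complex.Gamma μ) = R

/-- The fractional integral at `x` converges absolutely and equals the value at `x` of the
continuous extension of `rhs` (used only at a removable singularity `x` of `rhs`). -/
def HasFracIntLim (I : Set ℝ) (g : ℝ → ℂ) (μ : ℂ) (x : ℝ) (rhs : ℝ → ℂ) : Prop :=
  ∃ R, HasFracInt I g μ x R ∧ Tendsto rhs (𝓝[≠] x) (𝓝 R)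

/-! ## The eight types -/

/-- Parameters `(a, b, c)`. -/
@[ext] structure Par where
  a : ℂ
  b : ℂ
  c : ℂ

/-- The eight types of parameter changing transformations; `P` stands for `+`, `M` for `-`. -/
inductive Kind
  | cP | aPcP | aPbPcP | aM | aP | aMbMcM | aMcM | cM

/-- The target parameters `(a', b', c')`. -/
def Kind.shift (μ : ℂ) (p : Par) : Kind → Par
  | .cP => ⟨p.a, p.b, p.c + μ⟩
  | .aPcP => ⟨p.a + μ, p.b, p.c + μ⟩
  | .aPbPcP => ⟨p.a + μ, p.b + μ, p.c + μ⟩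
  | .aM => ⟨p.a - μ, p.b, p.c⟩
  | .aP => ⟨p.a + μ, p.b, p.c⟩
  | .aMbMcM => ⟨p.a - μ, p.b - μ, p.c - μ⟩
  | .aMcM => ⟨p.a - μ, p.b, p.c - μ⟩
  | .cM => ⟨p.a, p.b, p.c - μ⟩

/-- The weight `w(y)` under the integral sign. -/
def Kind.wt (μ : ℂ) (p : Par) (y : ℝ) : Kind → ℂ
  | .cP => absPow y (p.c - 1)
  | .aPcP => absPow y (p.c - 1) * absPow (1 - y) (p.b - p.c - μ)
  | .aPbPcP => absPow y (p.c - 1) * absPow (1 - y) (p.a + p.b - p.c)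
  | .aM => absPow y (p.a - μ - 1)
  | .aP => absPow y (p.c - p.a - μ - 1) * absPow (1 - y) (p.a + p.b - p.c)
  | .aMbMcM => 1
  | .aMcM => absPow (1 - y) (p.a - μ - 1)
  | .cM => absPow (1 - y) (p.a + p.b - p.c)

/-- The weight `v(x)` on the right-hand side. -/
def Kind.vt (μ : ℂ) (p : Par) (x : ℝ) : Kind → ℂ
  | .cP => absPow x (p.c + μ - 1)
  | .aPcP => absPow x (p.c + μ - 1) * absPow (1 - x) (p.b - p.c)
  | .aPbPcP => absPow x (p.c + μ - 1) * absPow (1 - x) (p.a + p.b - p.c + μ)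
  | .aM => absPow x (p.a - 1)
  | .aP => absPow x (p.c - p.a - 1) * absPow (1 - x) (p.a + p.b - p.c + μ)
  | .aMbMcM => 1
  | .aMcM => absPow (1 - x) (p.a - 1)
  | .cM => absPow (1 - x) (p.a + p.b - p.c + μ)

/-- The range of `x` in the formula for `w₁`. -/
def Kind.dom₁ : Kind → Set ℝ
  | .cP | .aPcP | .aPbPcP | .aM | .aP => {x | x < 1 ∧ x ≠ 0}
  | .aMbMcM | .aMcM | .cM => {x | x < 1}

/-- The integration set in the formula for `w₁`. -/
def Kind.reg₁ (x : ℝ) : Kind → Set ℝ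
  | .cP | .aPcP | .aPbPcP | .aM | .aP => {y | 0 < y / x ∧ y / x < 1}
  | .aMbMcM | .cM => Set.Iio x
  | .aMcM => Set.Ioo x 1

/-- The convergence conditions in the formula for `w₁`. -/
def Kind.cond₁ (μ : ℂ) (p : Par) : Kind → Prop
  | .cP | .aPcP | .aPbPcP => 0 < p.c.re ∧ 0 < μ.re
  | .aM => 0 < μ.re ∧ μ.re < p.a.re
  | .aP => 0 < μ.re ∧ μ.re < (p.c - p.a).re
  | .aMbMcM => 0 < μ.re ∧ μ.re < p.a.re ∧ μ.re < p.b.re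
  | .aMcM => 0 < μ.re ∧ μ.re < p.a.re ∧ μ.re < (p.c - p.b).re
  | .cM => 0 < μ.re ∧ μ.re < (p.c - p.a).re ∧ μ.re < (p.c - p.b).re

open Complex in
/-- The Gamma quotient in the formula for `w₁`. -/
def Kind.const₁ (μ : ℂ) (p : Par) : Kind → ℂ
  | .cP | .aPcP | .aPbPcP => Gamma p.c / Gamma (p.c + μ)
  | .aM => Gamma (p.a - μ) / Gamma p.a
  | .aP => Gamma (p.c - p.a - μ) / Gamma (p.c - p.a)
  | .aMbMcM => Gamma (p.a - μ) / Gamma p.a * (Gamma (p.b - μ) / Gamma p.b) *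
      (Gamma p.c / Gamma (p.c - μ))
  | .aMcM => Gamma (p.a - μ) / Gamma p.a * (Gamma (p.c - p.b - μ) / Gamma (p.c - p.b)) *
      (Gamma p.c / Gamma (p.c - μ))
  | .cM => Gamma (p.c - p.a - μ) / Gamma (p.c - p.a) *
      (Gamma (p.c - p.b - μ) / Gamma (p.c - p.b)) * (Gamma p.c / Gamma (p.c - μ))

/-! ## The table -/

/-- Labels of the six solutions. -/
inductive Sol
  | s₁ | s₂ | s₃ | s₄ | s₅ | s₆

/-- The solution with a given label. -/
def Sol.w (x : ℝ) (p : Par) : Sol → ℂ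
  | .s₁ => w₁ x p.a p.b p.c
  | .s₂ => w₂ x p.a p.b p.c
  | .s₃ => w₃ x p.a p.b p.c
  | .s₄ => w₄ x p.a p.b p.c
  | .s₅ => w₅ x p.a p.b p.c
  | .s₆ => w₆ x p.a p.b p.c

/-- The argument of the hypergeometric function in each solution: `x`, `1/x` or `1-x`. -/
def Sol.arg (x : ℝ) : Sol → ℝ
  | .s₁ | .s₂ => x
  | .s₃ | .s₄ => x⁻¹
  | .s₅ | .s₆ => 1 - x

/-- The parameters of the hypergeometric function in each solution. -/
def Sol.par (p : Par) : Sol → Par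
  | .s₁ => p
  | .s₂ => ⟨p.a - p.c + 1, p.b - p.c + 1, 2 - p.c⟩
  | .s₃ => ⟨p.a, p.a - p.c + 1, p.a - p.b + 1⟩
  | .s₄ => ⟨p.b, p.b - p.c + 1, p.b - p.a + 1⟩
  | .s₅ => ⟨p.a, p.b, p.a + p.b - p.c + 1⟩
  | .s₆ => ⟨p.c - p.a, p.c - p.b, p.c - p.a - p.b + 1⟩

/-- The table: rows are types, columns are solutions. The entry is the type of the formula for `w₁`
to which the formula for the solution reduces. -/
def Kind.table : Kind → Sol → Kind
  | .cP,     .s₁ => .cP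
  | .cP,     .s₂ => .aMbMcM
  | .cP,     .s₃ => .aM
  | .cP,     .s₄ => .aM
  | .cP,     .s₅ => .cM
  | .cP,     .s₆ => .aPbPcP
  | .aPcP,   .s₁ => .aPcP
  | .aPcP,   .s₂ => .aMcM
  | .aPcP,   .s₃ => .aPcP
  | .aPcP,   .s₄ => .aMcM
  | .aPcP,   .s₅ => .aP
  | .aPcP,   .s₆ => .aP
  | .aPbPcP, .s₁ => .aPbPcP
  | .aPbPcP, .s₂ => .cM
  | .aPbPcP, .s₃ => .aP
  | .aPbPcP, .s₄ => .aP
  | .aPbPcP, .s₅ => .aPbPcP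
  | .aPbPcP, .s₆ => .cM
  | .aM,     .s₁ => .aM
  | .aM,     .s₂ => .aM
  | .aM,     .s₃ => .aMbMcM
  | .aM,     .s₄ => .cP
  | .aM,     .s₅ => .aMcM
  | .aM,     .s₆ => .aPcP
  | .aP,     .s₁ => .aP
  | .aP,     .s₂ => .aP
  | .aP,     .s₃ => .aPbPcP
  | .aP,     .s₄ => .cM
  | .aP,     .s₅ => .aPcP
  | .aP,     .s₆ => .aMcM
  | .aMbMcM, .s₁ => .aMbMcM
  | .aMbMcM, .s₂ => .cP
  | .aMbMcM, .s₃ => .aM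
  | .aMbMcM, .s₄ => .aM
  | .aMbMcM, .s₅ => .aMbMcM
  | .aMbMcM, .s₆ => .cP
  | .aMcM,   .s₁ => .aMcM
  | .aMcM,   .s₂ => .aPcP
  | .aMcM,   .s₃ => .aMcM
  | .aMcM,   .s₄ => .aPcP
  | .aMcM,   .s₅ => .aM
  | .aMcM,   .s₆ => .aM
  | .cM,     .s₁ => .cM
  | .cM,     .s₂ => .aPbPcP
  | .cM,     .s₃ => .aP
  | .cM,     .s₄ => .aP
  | .cM,     .s₅ => .cP
  | .cM,     .s₆ => .aMbMcM

/-- Interchange of the two upper parameters. -/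
def Par.swap (p : Par) : Par := ⟨p.b, p.a, p.c⟩

/-- The parameters at which the formula for `w₁` of type `T.table j` has to be taken in order to
get the formula of type `T` for the solution `j`: those of the hypergeometric function in the
solution, with its upper parameters interchanged where it is the second of them (and not the
first) that plays the role of `a` in the formula for `w₁`. -/
def Kind.redPar (p : Par) (T : Kind) (j : Sol) : Par :=
  match T, j with
  | .aPcP, .s₂ | .aMcM, .s₂
  | .cP, .s₃ | .cM, .s₃
  | .cP, .s₄ | .aPcP, .s₄ | .aMcM, .s₄ | .cM, .s₄
  | .aPcP, .s₆ | .aMcM, .s₆ => (j.par p).swap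
  | _, _ => j.par p

/-- The points that have to be left out when the argument is `1/x`. -/
def Sol.excl : Sol → Set ℝ
  | .s₃ | .s₄ => {0}
  | _ => ∅

/-- Points inside the range of `x` at which a solution is left undefined only because of its power
factor; they matter only if that factor cancels against the weight. -/
def Sol.sing : Sol → Set ℝ
  | .s₂ => {0}
  | .s₆ => {1}
  | _ => ∅

/-- The range of `x` in the formula of type `T` for the solution `j`. -/
def Kind.dom (T : Kind) (j : Sol) : Set ℝ :=
  {x | x ∉ j.excl ∧ j.arg x ∈ (T.table j).dom₁}

/-- The integration set in the formula of type `T` for the solution `j`. (When the argument is `1/x`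
and the formula for `w₁` integrates over `(-∞, x)` or `(x, 1)`, this set is, for one sign of `x`, an
interval of the projective line through `∞`, i.e. a union of two half-lines; for the other sign it
is an ordinary interval with end point `x`.) -/
def Kind.reg (T : Kind) (j : Sol) (x : ℝ) : Set ℝ :=
  {y | y ∉ j.excl ∧ j.arg y ∈ (T.table j).reg₁ (j.arg x)}

/-- The conditions on the parameters in the formula of type `T` for the solution `j`: convergence
of the integral, and well-definedness of the hypergeometric series on both sides. -/
def Kind.cond (μ : ℂ) (p : Par) (T : Kind) (j : Sol) : Prop :=
  (T.table j).cond₁ μ (T.redPar p j) ∧ NotPole (j.par p).c ∧ NotPole (j.par (T.shift μ p)).c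

/-- The Gamma quotient in the formula of type `T` for the solution `j`. -/
def Kind.const (μ : ℂ) (p : Par) (T : Kind) (j : Sol) : ℂ :=
  (T.table j).const₁ μ (T.redPar p j)

/-- The right-hand side of the formula of type `T` for the solution `j`. -/
def Kind.rhs (μ : ℂ) (p : Par) (T : Kind) (j : Sol) (x : ℝ) : ℂ :=
  T.const μ p j * (T.vt μ p x * j.w x (T.shift μ p))

/-- The elementary factor `A(x)` that appears in the change of variable `y ↦ 1/y`. -/
def Sol.factor (μ : ℂ) (x : ℝ) : Sol → ℂ
  | .s₃ | .s₄ => absPow x (μ - 1)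
  | _ => 1

/-- The formula of type `T` for the solution `j` reduces to the formula of type `T.table j` for
`w₁` by the change of integration variable `t = j.arg y`: the shifted parameters correspond, and
the integrand and the right-hand side are, up to the same factor `A(x)`, those of the formula
for `w₁`. -/
def Reduces (μ : ℂ) (p : Par) (T : Kind) (j : Sol) : Prop :=
  T.redPar (T.shift μ p) j = (T.table j).shift μ (T.redPar p j) ∧
  (∀ x y : ℝ, x ≠ 0 → x ≠ 1 → y ≠ 0 → y ≠ 1 →
    T.wt μ p y * j.w y p * absPow (x - y) (μ - 1) =
      j.factor μ x * (((|deriv (fun t => j.arg t) y| : ℝ) : ℂ) *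
        ((T.table j).wt μ (T.redPar p j) (j.arg y) * Sol.s₁.w (j.arg y) (T.redPar p j) *
          absPow (j.arg x - j.arg y) (μ - 1)))) ∧
  (∀ x : ℝ, x ≠ 0 → x ≠ 1 →
    T.vt μ p x * j.w x (T.shift μ p) =
      j.factor μ x * ((T.table j).vt μ (T.redPar p j) (j.arg x) *
        Sol.s₁.w (j.arg x) ((T.table j).shift μ (T.redPar p j))))

end

end FracHyp

open FracHyp

/-! Everything comes down to `F(a,b;c;·)` on `(-∞,1)`. The series converges in the unit disc, and
Pfaff's formula `(1-z)^(-a) F(a,c-b;c;z/(z-1))` continues it to `Re z < 1/2`. The union of the two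
regions is star-shaped about `0` and contains `(-∞,1)`, so identities analytic in `z` need only be
checked on Taylor coefficients at `0`. Pfaff's formula itself is a rearrangement of a double series,
based on the Chu–Vandermonde sum.

Two types are basic on `0 < y/x < 1`. Putting `y = t x` gives the integral of `F(t x)` against the
beta kernel `t^(s-1) (1-t)^(μ-1)`, whose moments multiply the `n`-th coefficient by a constant times
`(s)ₙ/(s+μ)ₙ`. With `s = c` this raises `c` by `μ` (`hasFracInt_cP`); with `s = a-μ` it lowers `a`
by `μ` (`hasFracInt_aM`).

The third basic type, `a-,b-,c-` on `(-∞,x)`, follows when `Re b < Re c` by inserting Euler's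
integral and using Fubini: the fractional integral of `(1-yt)^(-a)` is again a beta integral. A
contiguous relation with constant coefficients then removes the restriction by induction
(`hasFracInt_aMbMcM`).

Euler's transformation, which absorbs the weight `|1-y|^(a+b-c)`, yields `a+,b+,c+`, `a+` and `c-`
from these three; the substitution `y/(y-1)` with Pfaff's transformation yields `a+,c+` and `a-,c-`.

Each other solution is a power times `F` at `x`, `1/x` or `1-x`. After the corresponding change of
variable the hypergeometric factors agree, and every table entry is a comparison of exponents
(`Kind.wt_mul_pref`, `Kind.vt_mul_pref`). -/

namespace FracHyp

noncomputable section

/-! ### Pochhammer symbols and the Chu–Vandermonde sum -/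

/-- The Pochhammer symbol `(a)ₙ`. -/
def poch (a : ℂ) (n : ℕ) : ℂ := (ascPochhammer ℂ n).eval a

theorem poch_zero (a : ℂ) : poch a 0 = 1 := by simp [poch]

theorem poch_succ (a : ℂ) (n : ℕ) : poch a (n + 1) = poch a n * (a + n) := by
  simp [poch, ascPochhammer_succ_eval]

theorem poch_succ' (a : ℂ) (n : ℕ) : poch a (n + 1) = a * poch (a + 1) n := by
  simp [poch, ascPochhammer_succ_left, Polynomial.eval_comp]

theorem poch_add (a : ℂ) (m n : ℕ) : poch a (m + n) = poch a m * poch (a + m) n := by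
  induction n with
  | zero => simp [poch_zero]
  | succ n ih => rw [← add_assoc, poch_succ, ih, poch_succ]; push_cast; ring

theorem NotPole.poch_ne_zero {c : ℂ} (hc : NotPole c) (n : ℕ) : poch c n ≠ 0 := by
  intro h
  obtain ⟨k, -, hk⟩ := (ascPochhammer_eval_eq_zero_iff n c).1 h
  exact hc k (by rw [hk, neg_neg])

theorem NotPole.ne_zero {c : ℂ} (hc : NotPole c) : c ≠ 0 := by simpa using hc 0

theorem NotPole.add_one {c : ℂ} (hc : NotPole c) : NotPole (c + 1) := fun n h =>
  hc (n + 1) (by push_cast; linear_combination h)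

theorem notPole_of_re_pos {c : ℂ} (hc : 0 < c.re) : NotPole c := fun n h => by
  rw [h] at hc
  simp only [Complex.neg_re, Complex.natCast_re] at hc
  linarith [(Nat.cast_nonneg n : (0 : ℝ) ≤ n)]

/-- The Chu–Vandermonde identity. -/
theorem sum_choose_poch (n : ℕ) (c d : ℂ) :
    ∑ ij ∈ Finset.HasAntidiagonal.antidiagonal n, (n.choose ij.1 : ℂ) *
      ((-1) ^ ij.1 * poch d ij.1 * poch (c + ij.1) ij.2) = poch (c - d) n := by
  induction n generalizing c d with
  | zero => simp [poch_zero]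
  | succ n ih =>
    rw [Finset.sum_antidiagonal_choose_succ_mul
      (fun i j => (-1) ^ i * poch d i * poch (c + i) j) n]
    -- Pascal's rule has split the sum in two. In the first part the extra factor `c + i + j = c +
    -- n` is constant on the antidiagonal; in the second, `c` and `d` both move up by one and `c -
    -- d` is unchanged. The total factor is `c - d + n`.
    have h1 : ∑ ij ∈ Finset.HasAntidiagonal.antidiagonal n, (n.choose ij.1 : ℂ) *
        ((-1) ^ ij.1 * poch d ij.1 * poch (c + ij.1) (ij.2 + 1)) = (c + n) * poch (c - d) n := by
      rw [← ih c d, Finset.mul_sum]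
      refine Finset.sum_congr rfl fun ij hij => ?_
      rw [← Finset.HasAntidiagonal.mem_antidiagonal.1 hij, poch_succ]
      push_cast; ring
    have h2 : ∑ ij ∈ Finset.HasAntidiagonal.antidiagonal n, (n.choose ij.2 : ℂ) *
        ((-1) ^ (ij.1 + 1) * poch d (ij.1 + 1) * poch (c + (ij.1 + 1 : ℕ)) ij.2) =
          -d * poch (c - d) n := by
      rw [show c - d = (c + 1) - (d + 1) by ring, ← ih (c + 1) (d + 1), Finset.mul_sum]
      refine Finset.sum_congr rfl fun ij hij => ?_
      have := Finset.HasAntidiagonal.mem_antidiagonal.1 hij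
      rw [Nat.choose_symm_of_eq_add (show n = ij.2 + ij.1 by omega), poch_succ']
      push_cast
      rw [show c + (ij.1 + 1 : ℂ) = c + 1 + ij.1 by ring]
      ring
    rw [h1, h2, poch_succ]
    ring

/-! ### The Gauss and binomial series in the unit disc -/

/-- The coefficients of the Gauss hypergeometric series. -/
def gaussCoef (a b c : ℂ) (n : ℕ) : ℂ := poch a n * poch b n / (poch c n * n.factorial)

theorem gaussCoef_eq (a b c : ℂ) : gaussCoef a b c = ordinaryHypergeometricCoefficient a b c := by
  funext n
  simp only [gaussCoef, ordinaryHypergeometricCoefficient, poch]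
  rw [div_eq_mul_inv, mul_inv]; ring

/-- The radius is one unless some parameter is a non-positive integer, in which case the series
terminates. This includes the lower parameter, because the inverse of zero is zero; hence no
condition on `c`. -/
theorem one_le_radius (a b c : ℂ) : 1 ≤ (ordinaryHypergeometricSeries ℂ a b c).radius := by
  by_cases h : ∀ k : ℕ, (k : ℂ) ≠ -a ∧ (k : ℂ) ≠ -b ∧ (k : ℂ) ≠ -c
  · rw [ordinaryHypergeometricSeries_radius_eq_one ℂ a b c h]
  · push Not at h
    obtain ⟨k, hk⟩ := h
    have : (k : ℂ) = -a ∨ (k : ℂ) = -b ∨ (k : ℂ) = -c := by tauto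
    rcases this with h | h | h
    · rw [show a = -(k : ℂ) by rw [h, neg_neg], ordinaryHypergeometric_radius_top_of_neg_nat₁]
      exact le_top
    · rw [show b = -(k : ℂ) by rw [h, neg_neg], ordinaryHypergeometric_radius_top_of_neg_nat₂]
      exact le_top
    · rw [show c = -(k : ℂ) by rw [h, neg_neg], ordinaryHypergeometric_radius_top_of_neg_nat₃]
      exact le_top

theorem hasFPowerSeriesOnBall_gauss (a b c : ℂ) :
    HasFPowerSeriesOnBall (ordinaryHypergeometric a b c : ℂ → ℂ)
      (ordinaryHypergeometricSeries ℂ a b c) 0 1 :=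
  ((ordinaryHypergeometricSeries ℂ a b c).hasFPowerSeriesOnBall
    (lt_of_lt_of_le one_pos (one_le_radius a b c))).mono one_pos (one_le_radius a b c)

theorem mem_eball_one {z : ℂ} (hz : ‖z‖ < 1) : z ∈ Metric.eball (0 : ℂ) 1 := by
  rw [← ENNReal.ofReal_one, Metric.eball_ofReal]; simpa using hz

theorem hasSum_gauss (a b c : ℂ) {z : ℂ} (hz : ‖z‖ < 1) :
    HasSum (fun n => gaussCoef a b c n * z ^ n) (ordinaryHypergeometric a b c z) := by
  have := (hasFPowerSeriesOnBall_gauss a b c).hasSum (mem_eball_one hz)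
  simpa [ordinaryHypergeometricSeries, gaussCoef_eq, mul_comm] using this

theorem summable_norm_gauss (a b c : ℂ) {r : ℝ} (hr0 : 0 ≤ r) (hr : r < 1) :
    Summable fun n => ‖gaussCoef a b c n‖ * r ^ n := by
  obtain ⟨s, rfl⟩ : ∃ s : NNReal, (s : ℝ) = r := ⟨⟨r, hr0⟩, rfl⟩
  have h : (s : ENNReal) < (ordinaryHypergeometricSeries ℂ a b c).radius :=
    lt_of_lt_of_le (by exact_mod_cast hr) (one_le_radius a b c)
  have := (ordinaryHypergeometricSeries ℂ a b c).summable_norm_mul_pow h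
  simpa [ordinaryHypergeometricSeries, gaussCoef_eq] using this

theorem ordinaryHypergeometric_self (a : ℂ) {b z : ℂ} (hb : NotPole b) (hz : ‖z‖ < 1) :
    ordinaryHypergeometric a b b z = (1 - z) ^ (-a) := by
  have h := Complex.one_add_cpow_hasFPowerSeriesOnBall_zero (a := -a)
  have h1 := h.hasSum (mem_eball_one (z := -z) (by simpa using hz))
  rw [binomialSeries_eq_ordinaryHypergeometricSeries (b := b)
    (fun k hk => hb k (by rw [hk, neg_neg]))] at h1
  have h2 := hasSum_gauss a b b hz
  refine h2.unique ?_
  rw [zero_add, ← sub_eq_add_neg] at h1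
  convert! h1 using 2 with n
  rw [FormalMultilinearSeries.compContinuousLinearMap_apply,
    show (⇑(-ContinuousLinearMap.id ℂ ℂ) ∘ fun _ : Fin n => -z) = fun _ => z by ext; simp,
    ordinaryHypergeometricSeries, FormalMultilinearSeries.ofScalars_apply_eq, gaussCoef_eq,
    smul_eq_mul, neg_neg]

theorem hasSum_one_sub_cpow (a : ℂ) {z : ℂ} (hz : ‖z‖ < 1) :
    HasSum (fun n => poch a n / n.factorial * z ^ n) ((1 - z) ^ (-a)) := by
  have h1 : NotPole 1 := notPole_of_re_pos (by simp)
  rw [← ordinaryHypergeometric_self a h1 hz]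
  convert hasSum_gauss a 1 1 hz using 3 with n
  rw [gaussCoef]
  have := h1.poch_ne_zero n
  field_simp

theorem poch_ofReal_nonneg {s : ℝ} (hs : 0 ≤ s) (n : ℕ) :
    poch (s : ℂ) n = (‖poch (s : ℂ) n‖ : ℝ) := by
  induction n with
  | zero => simp [poch_zero]
  | succ n ih =>
    rw [poch_succ, norm_mul, Complex.ofReal_mul, ← ih, ← Complex.ofReal_natCast,
      ← Complex.ofReal_add, Complex.norm_real, Real.norm_of_nonneg (by positivity)]

/-- A majorant of the binomial series. -/
theorem tsum_norm_poch_le (a : ℂ) {s : ℝ} (hs : ‖a‖ ≤ s) {r : ℝ} (hr0 : 0 ≤ r) (hr : r < 1) :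
    Summable (fun n => ‖poch a n‖ / n.factorial * r ^ n) ∧
      ∑' n : ℕ, ‖poch a n‖ / n.factorial * r ^ n ≤ (1 - r) ^ (-s) := by
  have hs0 : 0 ≤ s := (norm_nonneg a).trans hs
  have h := hasSum_one_sub_cpow (s : ℂ) (z := (r : ℂ))
    (by rw [Complex.norm_real, Real.norm_of_nonneg hr0]; exact hr)
  have h' : HasSum (fun n => ‖poch (s : ℂ) n‖ / n.factorial * r ^ n) ((1 - r) ^ (-s)) := by
    rw [← Complex.hasSum_ofReal]
    convert h using 2 with n
    · rw [poch_ofReal_nonneg hs0]; push_cast; simp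
    · rw [Complex.ofReal_cpow (by linarith)]; push_cast; rfl
  -- Factor by factor, `|a + n| ≤ s + n`, and the series with `s` in place of `a` sums to
  -- `(1-r)^(-s)`.
  have hle : ∀ n : ℕ, ‖poch a n‖ / n.factorial * r ^ n ≤
      ‖poch (s : ℂ) n‖ / n.factorial * r ^ n := by
    intro n
    gcongr
    induction n with
    | zero => simp [poch_zero]
    | succ n ih =>
      rw [poch_succ, poch_succ, norm_mul, norm_mul]
      gcongr
      have : ‖(s : ℂ) + n‖ = s + n := by
        rw [← Complex.ofReal_natCast, ← Complex.ofReal_add, Complex.norm_real,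
          Real.norm_of_nonneg (by positivity)]
      rw [this]
      refine (norm_add_le a n).trans ?_
      simpa using hs
  have hsum : Summable (fun n => ‖poch a n‖ / n.factorial * r ^ n) :=
    Summable.of_nonneg_of_le (fun n => by positivity) hle h'.summable
  exact ⟨hsum, (hsum.tsum_le_tsum hle h'.summable).trans h'.tsum_eq.le⟩

/-! ### Pfaff's transformation near the origin -/

/-- This compares the coefficients of `zⁿ` in Pfaff's formula, where `(1-z)^(-a) (z/(z-1))^k =
(-1)^k z^k (1-z)^(-a-k)` is expanded by the binomial series. It is the Chu–Vandermonde sum with `d =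
c - b`, multiplied by `(a)ₙ / ((c)ₙ n!)`. -/
theorem gaussCoef_pfaff (a b : ℂ) {c : ℂ} (hc : NotPole c) (n : ℕ) :
    ∑ ij ∈ Finset.HasAntidiagonal.antidiagonal n, gaussCoef a (c - b) c ij.1 * (-1) ^ ij.1 *
      (poch (a + ij.1) ij.2 / ij.2.factorial) = gaussCoef a b c n := by
  have key := sum_choose_poch n c (c - b)
  rw [sub_sub_cancel] at key
  rw [gaussCoef, ← key, Finset.mul_sum, Finset.sum_div]
  refine Finset.sum_congr rfl fun ij hij => ?_
  obtain ⟨i, j⟩ := ij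
  have hn : i + j = n := Finset.HasAntidiagonal.mem_antidiagonal.1 hij
  subst hn
  have hi := hc.poch_ne_zero i
  have hij' := hc.poch_ne_zero (i + j)
  rw [poch_add c] at hij' ⊢
  have hj : poch (c + i) j ≠ 0 := right_ne_zero_of_mul hij'
  have hch : (((i + j).choose i : ℕ) : ℂ) * i.factorial * j.factorial = (i + j).factorial := by
    rw [Nat.choose_symm_add]
    exact_mod_cast Nat.add_choose_mul_factorial_mul_factorial i j
  have f1 : (i.factorial : ℂ) ≠ 0 := by exact_mod_cast i.factorial_ne_zero
  have f2 : (j.factorial : ℂ) ≠ 0 := by exact_mod_cast j.factorial_ne_zero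
  have f3 : ((i + j).factorial : ℂ) ≠ 0 := by exact_mod_cast (i + j).factorial_ne_zero
  simp only [gaussCoef]
  rw [poch_add a]
  field_simp
  rw [← hch]
  ring

/-- The double series `f` sums to the left side along rows, by the binomial series, and to the right
side along antidiagonals, by `gaussCoef_pfaff`. Absolute convergence justifies the exchange. -/
theorem pfaff_near_zero (a b : ℂ) {c : ℂ} (hc : NotPole c) {z : ℂ} (hz : ‖z‖ < 1 / 3) :
    (1 - z) ^ (-a) * ordinaryHypergeometric a (c - b) c (z / (z - 1)) =
      ordinaryHypergeometric a b c z := by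
  set r := ‖z‖ with hr
  have hr0 : 0 ≤ r := norm_nonneg z
  have hz1 : (1 : ℂ) - z ≠ 0 := by
    intro h
    have : ‖z‖ = 1 := by rw [← sub_eq_zero.1 h]; simp
    linarith
  have hz1' : z - 1 ≠ 0 := by rw [← neg_sub]; exact neg_ne_zero.2 hz1
  have hn : 1 - r ≤ ‖1 - z‖ := by simpa using norm_sub_norm_le (1 : ℂ) z
  have hw : ‖z / (z - 1)‖ < 1 := by
    rw [norm_div, norm_sub_rev z 1, div_lt_one (by linarith)]; linarith
  set f : ℕ × ℕ → ℂ := fun p =>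
    gaussCoef a (c - b) c p.1 * (-1) ^ p.1 * (poch (a + p.1) p.2 / p.2.factorial) * z ^ (p.1 + p.2)
    with hf
  have hfib : ∀ k, HasSum (fun m => f (k, m))
      (gaussCoef a (c - b) c k * (-1) ^ k * z ^ k * (1 - z) ^ (-(a + k))) := by
    intro k
    have := (hasSum_one_sub_cpow (a + k) (z := z) (by linarith)).mul_left
      (gaussCoef a (c - b) c k * (-1) ^ k * z ^ k)
    refine this.congr_fun fun m => ?_
    simp only [hf]; ring
  have hnorm : ∀ p, ‖f p‖ = ‖gaussCoef a (c - b) c p.1‖ * r ^ p.1 *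
      (‖poch (a + p.1) p.2‖ / p.2.factorial * r ^ p.2) := by
    intro p
    simp only [hf, norm_mul, norm_pow, norm_neg, norm_one, one_pow, norm_div, Complex.norm_natCast,
      pow_add, ← hr]
    ring
  have hmaj : ∀ k : ℕ, ‖a + k‖ ≤ ‖a‖ + k := fun k => by simpa using norm_add_le a (k : ℂ)
  have hsumf : Summable f := by
    rw [← summable_norm_iff, summable_prod_of_nonneg (fun p => norm_nonneg _)]
    refine ⟨fun k => ?_, ?_⟩
    · refine Summable.congr ?_ fun y => (hnorm (k, y)).symm
      dsimp only
      exact (tsum_norm_poch_le (a + k) (hmaj k) hr0 (by linarith)).1.mul_left _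
    simp only [hnorm]
    -- Row `k` is at most `(1-r)^(-‖a‖)` times the modulus of the `k`-th coefficient times
    -- `(r/(1-r))^k`. This is summable for `r < 1/2`; the bound `1/3` leaves room.
    have hq : r / (1 - r) < 1 := by rw [div_lt_one (by linarith)]; linarith
    refine Summable.of_nonneg_of_le (fun k => tsum_nonneg fun m => by positivity) (fun k => ?_)
      ((summable_norm_gauss a (c - b) c (div_nonneg hr0 (by linarith)) hq).mul_left
        ((1 - r) ^ (-‖a‖)))
    rw [tsum_mul_left]
    refine (mul_le_mul_of_nonneg_left
      (tsum_norm_poch_le (a + k) (hmaj k) hr0 (by linarith)).2 (by positivity)).trans (le_of_eq ?_)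
    have h1r : 0 < 1 - r := by linarith
    rw [neg_add, Real.rpow_add h1r, Real.rpow_neg h1r.le (k : ℝ), Real.rpow_natCast, div_pow]
    field_simp
  have hL : HasSum (fun k => gaussCoef a (c - b) c k * (-1) ^ k * z ^ k * (1 - z) ^ (-(a + k)))
      (∑' p, f p) := hsumf.hasSum.prod_fiberwise hfib
  have hL' : HasSum (fun k => gaussCoef a (c - b) c k * (-1) ^ k * z ^ k * (1 - z) ^ (-(a + k)))
      ((1 - z) ^ (-a) * ordinaryHypergeometric a (c - b) c (z / (z - 1))) := by
    refine ((hasSum_gauss a (c - b) c hw).mul_left ((1 - z) ^ (-a))).congr_fun fun k => ?_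
    rw [neg_add, Complex.cpow_add _ _ hz1, Complex.cpow_neg (1 - z) (k : ℂ), Complex.cpow_natCast,
      ← neg_sub 1 z, div_neg, neg_pow (z / (1 - z)), div_pow]
    field_simp
  have hR : HasSum (fun n => gaussCoef a b c n * z ^ n) (∑' p, f p) := by
    have h1 := (Finset.HasAntidiagonal.sigmaAntidiagonalEquivProd.hasSum_iff (f := f)).2
      hsumf.hasSum
    have h2 := h1.sigma (fun n => hasSum_fintype _)
    convert h2 using 2 with n
    rw [← gaussCoef_pfaff a b hc n, Finset.sum_mul]
    simp only [Function.comp_def, Finset.HasAntidiagonal.sigmaAntidiagonalEquivProd_apply,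
      Finset.univ_eq_attach]
    rw [Finset.sum_attach (Finset.HasAntidiagonal.antidiagonal n) (fun p => f p)]
    refine Finset.sum_congr rfl fun ij hij => ?_
    simp only [hf, Finset.HasAntidiagonal.mem_antidiagonal.1 hij]
  rw [hL'.unique hL, hR.unique (hasSum_gauss a b c (by linarith))]

/-! ### Analytic continuation to the disc and the half plane -/

theorem IsGaussValue.gaussF_eq {a b c z v : ℂ} (h : IsGaussValue a b c z v) :
    gaussF a b c z = v := by
  have hex : ∃ v, IsGaussValue a b c z v := ⟨v, h⟩
  rw [gaussF, dif_pos hex]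
  exact hex.choose_spec.unique h

theorem ordinaryHypergeometric_symm (a b c : ℂ) :
    (ordinaryHypergeometric a b c : ℂ → ℂ) = ordinaryHypergeometric b a c := by
  funext z
  rw [ordinaryHypergeometric, ordinaryHypergeometric, ordinaryHypergeometricSeries_symm]

theorem gaussF_symm (a b c z : ℂ) : gaussF a b c z = gaussF b a c z := by
  have h : IsGaussValue a b c z = IsGaussValue b a c z := by
    funext v
    simp only [IsGaussValue, ordinaryHypergeometric_symm a b c]
  by_cases hv : ∃ v, IsGaussValue a b c z v
  · obtain ⟨v, hv⟩ := hv
    rw [hv.gaussF_eq, (h ▸ hv : IsGaussValue b a c z v).gaussF_eq]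
  · rw [gaussF, gaussF, dif_neg hv, dif_neg (h ▸ hv)]

/-- The half plane `Re z < 1/2`, on which `|z / (z - 1)| < 1`. -/
def halfPlane : Set ℂ := {z | z.re < 1 / 2}

/-- The union of the unit disc and the half plane `Re z < 1/2`; it contains the half-line
`(-∞, 1)`. -/
def baseDom : Set ℂ := Metric.ball 0 1 ∪ halfPlane

theorem isOpen_halfPlane : IsOpen halfPlane := isOpen_lt Complex.continuous_re continuous_const

theorem isOpen_baseDom : IsOpen baseDom := Metric.isOpen_ball.union isOpen_halfPlane

theorem zero_mem_halfPlane : (0 : ℂ) ∈ halfPlane := by simp [halfPlane]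

theorem zero_mem_baseDom : (0 : ℂ) ∈ baseDom := Or.inr zero_mem_halfPlane

theorem starConvex_halfPlane : StarConvex ℝ 0 halfPlane :=
  (convex_halfSpace_re_lt (1 / 2)).starConvex zero_mem_halfPlane

theorem starConvex_ball : StarConvex ℝ 0 (Metric.ball (0 : ℂ) 1) :=
  (convex_ball (0 : ℂ) 1).starConvex (by simp)

theorem starConvex_baseDom : StarConvex ℝ 0 baseDom := starConvex_ball.union starConvex_halfPlane

theorem disjoint_baseDom_cut : Disjoint baseDom cut := by
  rw [Set.disjoint_left]
  rintro z (hz | hz) ⟨-, h1⟩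
  · have := (Complex.re_le_norm z)
    have hz' : ‖z‖ < 1 := by simpa using hz
    linarith
  · have : z.re < 1 / 2 := hz
    linarith

theorem ofReal_mem_baseDom {x : ℝ} (hx : x < 1) : (x : ℂ) ∈ baseDom := by
  by_cases h : x < 1 / 2
  · exact Or.inr (by simpa [halfPlane] using h)
  · left
    rw [mem_ball_zero_iff, Complex.norm_real, Real.norm_eq_abs, abs_lt]
    constructor <;> linarith

theorem isGaussValue_of_analytic {a b c z : ℂ} {U : Set ℂ} {f : ℂ → ℂ} (hU : IsOpen U)
    (hs : StarConvex ℝ 0 U) (h0 : 0 ∈ U) (hd : U ⊆ baseDom) (hf : AnalyticOnNhd ℂ f U)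
    (he : ∀ᶠ t in 𝓝 (0 : ℂ), f t = ordinaryHypergeometric a b c t) (hz : z ∈ U) :
    gaussF a b c z = f z :=
  IsGaussValue.gaussF_eq
    ⟨U, f, hU, hs, h0, hz, disjoint_baseDom_cut.mono_left hd, hf, he, rfl⟩

theorem analyticOnNhd_ordinaryHypergeometric (a b c : ℂ) :
    AnalyticOnNhd ℂ (ordinaryHypergeometric a b c : ℂ → ℂ) (Metric.ball 0 1) := by
  have := (hasFPowerSeriesOnBall_gauss a b c).analyticOnNhd
  rwa [← ENNReal.ofReal_one, Metric.eball_ofReal] at this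

theorem gaussF_eq_of_norm_lt_one (a b c : ℂ) {z : ℂ} (hz : ‖z‖ < 1) :
    gaussF a b c z = ordinaryHypergeometric a b c z :=
  isGaussValue_of_analytic Metric.isOpen_ball starConvex_ball (by simp) Set.subset_union_left
    (analyticOnNhd_ordinaryHypergeometric a b c) (Eventually.of_forall fun _ => rfl) (by simpa)

theorem gaussF_eventuallyEq (a b c : ℂ) :
    ∀ᶠ t in 𝓝 (0 : ℂ), gaussF a b c t = ordinaryHypergeometric a b c t := by
  filter_upwards [Metric.ball_mem_nhds (0 : ℂ) one_pos] with t ht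
  exact gaussF_eq_of_norm_lt_one a b c (by simpa using ht)

theorem norm_div_sub_one_lt {z : ℂ} (hz : z ∈ halfPlane) : ‖z / (z - 1)‖ < 1 := by
  have hz' : z.re < 1 / 2 := hz
  have hne : z - 1 ≠ 0 := by
    intro h
    rw [sub_eq_zero.1 h] at hz'
    norm_num at hz'
  rw [norm_div, div_lt_one (norm_pos_iff.2 hne)]
  refine lt_of_pow_lt_pow_left₀ 2 (norm_nonneg _) ?_
  rw [Complex.sq_norm, Complex.sq_norm, Complex.normSq_apply, Complex.normSq_apply]
  simp only [Complex.sub_re, Complex.sub_im, Complex.one_re, Complex.one_im]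
  nlinarith

theorem analyticOnNhd_pfaff (a b c : ℂ) : AnalyticOnNhd ℂ
    (fun z : ℂ => (1 - z) ^ (-a) * ordinaryHypergeometric a b c (z / (z - 1))) halfPlane := by
  intro z hz
  have hz' : z.re < 1 / 2 := hz
  have hne : z - 1 ≠ 0 := by
    intro h
    rw [sub_eq_zero.1 h] at hz'
    norm_num at hz'
  refine AnalyticAt.mul ?_ ?_
  · refine AnalyticAt.cpow (by fun_prop) (by fun_prop) (Or.inl ?_)
    simp only [Complex.sub_re, Complex.one_re]; linarith
  · refine AnalyticAt.fun_comp (analyticOnNhd_ordinaryHypergeometric a b c _ ?_) ?_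
    · simpa using norm_div_sub_one_lt hz
    · exact analyticAt_id.div (by fun_prop) hne

/-- The right side is analytic on the half plane and equals the series near `0`, so it is the
continuation there. -/
theorem gaussF_eq_of_mem_halfPlane (a b : ℂ) {c : ℂ} (hc : NotPole c) {z : ℂ}
    (hz : z ∈ halfPlane) :
    gaussF a b c z = (1 - z) ^ (-a) * ordinaryHypergeometric a (c - b) c (z / (z - 1)) := by
  refine isGaussValue_of_analytic (U := halfPlane) (f := fun z : ℂ =>
    (1 - z) ^ (-a) * ordinaryHypergeometric a (c - b) c (z / (z - 1))) isOpen_halfPlane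
    starConvex_halfPlane zero_mem_halfPlane Set.subset_union_right (analyticOnNhd_pfaff _ _ _) ?_ hz
  filter_upwards [Metric.ball_mem_nhds (0 : ℂ) (by norm_num : (0 : ℝ) < 1 / 3)] with t ht
  exact pfaff_near_zero a b hc (by simpa using ht)

/-- The two local expressions need no gluing: `gaussF` does not depend on the domain used for the
continuation, so it coincides with each of them on its own open region. -/
theorem analyticOnNhd_gaussF (a b : ℂ) {c : ℂ} (hc : NotPole c) :
    AnalyticOnNhd ℂ (gaussF a b c) baseDom := by
  rintro z (hz | hz)
  · refine (analyticOnNhd_ordinaryHypergeometric a b c z hz).congr ?_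
    filter_upwards [Metric.isOpen_ball.mem_nhds hz] with t ht
    exact (gaussF_eq_of_norm_lt_one a b c (by simpa using ht)).symm
  · refine (analyticOnNhd_pfaff a (c - b) c z hz).congr ?_
    filter_upwards [isOpen_halfPlane.mem_nhds hz] with t ht
    exact (gaussF_eq_of_mem_halfPlane a b hc ht).symm

/-- The form of the identity theorem used below: an identity on `baseDom` follows from analyticity
of both sides and agreement of power series at `0`. -/
theorem gaussF_eq_of_analyticOnNhd {a b c z : ℂ} {f : ℂ → ℂ} (hf : AnalyticOnNhd ℂ f baseDom)
    (he : ∀ᶠ t in 𝓝 (0 : ℂ), f t = ordinaryHypergeometric a b c t) (hz : z ∈ baseDom) :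
    gaussF a b c z = f z :=
  isGaussValue_of_analytic isOpen_baseDom starConvex_baseDom zero_mem_baseDom le_rfl hf he hz

theorem continuousOn_gaussF (a b : ℂ) {c : ℂ} (hc : NotPole c) :
    ContinuousOn (fun x : ℝ => gaussF a b c (x : ℂ)) (Set.Iio 1) :=
  (analyticOnNhd_gaussF a b hc).continuousOn.comp Complex.continuous_ofReal.continuousOn
    fun _ hx => ofReal_mem_baseDom hx

/-! ### Transformations of Pfaff and Euler, and a contiguous relation -/

theorem gaussF_pfaff_of_lt (a b : ℂ) {c : ℂ} (hc : NotPole c) {x : ℝ} (hx : x < 1 / 2) :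
    gaussF a b c (x : ℂ) =
      ((1 - x : ℝ) : ℂ) ^ (-a) * gaussF a (c - b) c ((x / (x - 1) : ℝ) : ℂ) := by
  have hz : (x : ℂ) ∈ halfPlane := by simpa [halfPlane] using hx
  have hn := norm_div_sub_one_lt hz
  rw [gaussF_eq_of_mem_halfPlane a b hc hz]
  push_cast
  rw [gaussF_eq_of_norm_lt_one _ _ _ hn]

/-- **Pfaff's transformation** on the half-line `(-∞, 1)`. -/
theorem gaussF_pfaff (a b : ℂ) {c : ℂ} (hc : NotPole c) {x : ℝ} (hx : x < 1) :
    gaussF a b c (x : ℂ) =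
      ((1 - x : ℝ) : ℂ) ^ (-a) * gaussF a (c - b) c ((x / (x - 1) : ℝ) : ℂ) := by
  by_cases h : x < 1 / 2
  · exact gaussF_pfaff_of_lt a b hc h
  -- For `x ≥ 1/2` the point `x/(x-1)` lies below `1/2`. The map `x ↦ x/(x-1)` is an involution, so
  -- the identity at that point, with `c - b` for `b`, can be solved for the value at `x`.
  · have h1 : x - 1 ≠ 0 := by linarith
    have h2 : 0 < 1 - x := by linarith
    have hw : x / (x - 1) < 1 / 2 := by
      rw [← neg_sub, div_neg, neg_lt, lt_div_iff₀ h2]; linarith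
    have h3 : 1 - x / (x - 1) = (1 - x)⁻¹ := by
      rw [← neg_sub 1 x, div_neg]; field_simp; ring
    have h4 : x / (x - 1) / (x / (x - 1) - 1) = x := by
      have : x / (x - 1) - 1 = (x - 1)⁻¹ := by field_simp; ring
      rw [this]; field_simp
    have key := gaussF_pfaff_of_lt a (c - b) hc hw
    rw [h3, h4, sub_sub_cancel] at key
    rw [key, ← mul_assoc, Complex.ofReal_inv, Complex.inv_cpow _ _
      (by rw [Complex.arg_ofReal_of_nonneg h2.le]; exact Real.pi_pos.ne), mul_inv_cancel₀, one_mul]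
    exact Complex.cpow_ne_zero_iff.2 (Or.inl (by exact_mod_cast h2.ne'))

/-- **Euler's transformation** on the half-line `(-∞, 1)`. -/
theorem gaussF_euler (a b : ℂ) {c : ℂ} (hc : NotPole c) {x : ℝ} (hx : x < 1) :
    gaussF a b c (x : ℂ) = ((1 - x : ℝ) : ℂ) ^ (c - a - b) * gaussF (c - a) (c - b) c (x : ℂ) := by
  have h1 : 0 < 1 - x := by linarith
  -- Pfaff in `a` on the left and in `c - b` on the right lead to the same function at `x/(x-1)`.
  rw [gaussF_pfaff a b hc hx, gaussF_symm (c - a), gaussF_pfaff (c - b) (c - a) hc hx,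
    sub_sub_cancel, gaussF_symm (c - b) a, ← mul_assoc,
    ← Complex.cpow_add _ _ (by exact_mod_cast h1.ne')]
  congr 2
  ring

theorem gaussF_zero_right (a c z : ℂ) (hz : z ∈ baseDom) : gaussF a 0 c z = 1 := by
  refine gaussF_eq_of_analyticOnNhd (f := fun _ => 1) analyticOnNhd_const ?_ hz
  filter_upwards [Metric.ball_mem_nhds (0 : ℂ) one_pos] with t ht
  refine HasSum.unique ?_ (hasSum_gauss a 0 c (by simpa using ht))
  convert hasSum_single (f := fun n => gaussCoef a 0 c n * t ^ n) 0 ?_ using 1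
  · simp [gaussCoef, poch_zero]
  · rintro (_ | n) hn
    · exact absurd rfl hn
    · simp [gaussCoef, poch_succ']

theorem div_sub_one_lt_one {x : ℝ} (hx : x < 1) : x / (x - 1) < 1 := by
  rw [← neg_sub, div_neg, neg_lt, lt_div_iff₀ (by linarith)]; linarith

/-- Pfaff's transformation leaves a series with upper parameter `b - b = 0`, which is constant. -/
theorem gaussF_self (a : ℂ) {b : ℂ} (hb : NotPole b) {x : ℝ} (hx : x < 1) :
    gaussF a b b (x : ℂ) = ((1 - x : ℝ) : ℂ) ^ (-a) := by
  rw [gaussF_pfaff a b hb hx, sub_self,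
    gaussF_zero_right _ _ _ (ofReal_mem_baseDom (div_sub_one_lt_one hx)), mul_one]

/-- A contiguous relation with constant coefficients. -/
theorem gaussF_contiguous (a b : ℂ) {c : ℂ} (hc : NotPole c) {z : ℂ} (hz : z ∈ baseDom) :
    c * gaussF a b c z = a * gaussF (a + 1) b (c + 1) z - (a - c) * gaussF a b (c + 1) z := by
  have h := gaussF_eq_of_analyticOnNhd (a := a) (b := b) (c := c)
    (f := fun z => c⁻¹ * (a * gaussF (a + 1) b (c + 1) z - (a - c) * gaussF a b (c + 1) z))
    ?_ ?_ hz
  · rw [h, mul_inv_cancel_left₀ hc.ne_zero]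
  · exact analyticOnNhd_const.mul
      ((analyticOnNhd_const.mul (analyticOnNhd_gaussF _ _ hc.add_one)).sub
        (analyticOnNhd_const.mul (analyticOnNhd_gaussF _ _ hc.add_one)))
  · filter_upwards [Metric.ball_mem_nhds (0 : ℂ) one_pos, gaussF_eventuallyEq (a + 1) b (c + 1),
      gaussF_eventuallyEq a b (c + 1)] with t ht h1 h2
    rw [h1, h2]
    have ht' : ‖t‖ < 1 := by simpa using ht
    refine HasSum.unique ?_ (hasSum_gauss a b c ht')
    refine (((((hasSum_gauss (a + 1) b (c + 1) ht').mul_left a).sub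
      ((hasSum_gauss a b (c + 1) ht').mul_left (a - c)))).mul_left c⁻¹).congr_fun fun n => ?_
    have hc0 := hc.ne_zero
    have h3 := hc.add_one.poch_ne_zero n
    have h4 := hc.poch_ne_zero n
    have h5 : (n.factorial : ℂ) ≠ 0 := by exact_mod_cast n.factorial_ne_zero
    -- The relation holds coefficient by coefficient: `e1` and `e2` express the shifted symbols
    -- `(a+1)ₙ` and `(c+1)ₙ` through `(a)ₙ` and `(c)ₙ`.
    have e1 : poch a n * (a + n) = a * poch (a + 1) n := by rw [← poch_succ, poch_succ']
    have e2 : poch c n * (c + n) = c * poch (c + 1) n := by rw [← poch_succ, poch_succ']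
    simp only [gaussCoef]
    field_simp
    linear_combination (poch b n * t ^ n * poch c n) * e1 - (poch a n * poch b n * t ^ n) * e2

/-! ### Integration of dilates against a beta kernel -/

theorem mul_mem_baseDom {z : ℂ} (hz : z ∈ baseDom) {t : ℝ} (ht : t ∈ Set.Icc (0 : ℝ) 1) :
    (t : ℂ) * z ∈ baseDom := by
  have := starConvex_baseDom.smul_mem hz ht.1 ht.2
  simpa using this

theorem continuousOn_scale {F : ℂ → ℂ} (hF : ContinuousOn F baseDom) {z : ℂ} (hz : z ∈ baseDom) :
    ContinuousOn (fun t : ℝ => F (t * z)) (Set.Icc 0 1) :=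
  hF.comp (by fun_prop) fun _ ht => mul_mem_baseDom hz ht

theorem integrableOn_scale {k : ℝ → ℂ} (hk : IntegrableOn k (Set.Ioo 0 1)) {F : ℂ → ℂ}
    (hF : ContinuousOn F baseDom) {z : ℂ} (hz : z ∈ baseDom) :
    IntegrableOn (fun t : ℝ => k t * F (t * z)) (Set.Ioo 0 1) :=
  hk.mul_continuousOn_of_subset (continuousOn_scale hF hz) measurableSet_Ioo isCompact_Icc
    Set.Ioo_subset_Icc_self

/-- Differentiation under the integral sign. Dilates `t z` stay in the star-shaped domain, and `t
F'(t z)` is bounded on the compact set of `t ∈ [0,1]` and `z` in a small closed ball, so a multiple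
of `‖k‖` dominates. -/
theorem analyticOnNhd_integral_scale {k : ℝ → ℂ} (hk : IntegrableOn k (Set.Ioo 0 1)) {F : ℂ → ℂ}
    (hF : AnalyticOnNhd ℂ F baseDom) :
    AnalyticOnNhd ℂ (fun z => ∫ t in Set.Ioo (0 : ℝ) 1, k t * F (t * z)) baseDom := by
  refine DifferentiableOn.analyticOnNhd (fun z₀ hz₀ => ?_) isOpen_baseDom
  obtain ⟨ε, hε, hball⟩ := Metric.isOpen_iff.1 isOpen_baseDom z₀ hz₀
  set s := Metric.closedBall z₀ (ε / 2)
  have hs : s ⊆ baseDom := (Metric.closedBall_subset_ball (by linarith)).trans hball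
  have hF' : ContinuousOn (deriv F) baseDom := hF.deriv.continuousOn
  have hcpt : IsCompact (Set.Icc (0 : ℝ) 1 ×ˢ s) := isCompact_Icc.prod (isCompact_closedBall _ _)
  have hmaps : ∀ p ∈ Set.Icc (0 : ℝ) 1 ×ˢ s, ((p.1 : ℝ) : ℂ) * p.2 ∈ baseDom := fun p hp =>
    mul_mem_baseDom (hs hp.2) hp.1
  obtain ⟨C, hC⟩ := hcpt.exists_bound_of_continuousOn
    (f := fun p : ℝ × ℂ => (p.1 : ℂ) * deriv F (p.1 * p.2))
    ((by fun_prop : Continuous fun p : ℝ × ℂ => (p.1 : ℂ)).continuousOn.mul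
      (hF'.comp (by fun_prop) hmaps))
  have h := hasDerivAt_integral_of_dominated_loc_of_deriv_le
    (μ := volume.restrict (Set.Ioo (0 : ℝ) 1)) (x₀ := z₀) (s := s)
    (F := fun z t => k t * F (t * z)) (F' := fun z t => k t * (t * deriv F (t * z)))
    (bound := fun t => ‖k t‖ * C) (Metric.closedBall_mem_nhds _ (by linarith)) ?_ ?_ ?_ ?_ ?_ ?_
  · exact h.2.differentiableAt.differentiableWithinAt
  · filter_upwards [isOpen_baseDom.mem_nhds hz₀] with z hz
    exact (integrableOn_scale hk hF.continuousOn hz).aestronglyMeasurable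
  · exact integrableOn_scale hk hF.continuousOn hz₀
  · exact (hk.mul_continuousOn_of_subset (K := Set.Icc 0 1)
      ((Complex.continuous_ofReal.continuousOn).mul (continuousOn_scale hF' hz₀))
      measurableSet_Ioo isCompact_Icc Set.Ioo_subset_Icc_self).aestronglyMeasurable
  · filter_upwards [ae_restrict_mem measurableSet_Ioo] with t ht z hz
    rw [norm_mul]
    exact mul_le_mul_of_nonneg_left (hC (t, z) ⟨Set.Ioo_subset_Icc_self ht, hz⟩) (norm_nonneg _)
  · exact hk.norm.mul_const C
  · filter_upwards [ae_restrict_mem measurableSet_Ioo] with t ht z hz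
    have h1 := (hF _ (mul_mem_baseDom (hs hz) (Set.Ioo_subset_Icc_self ht))).differentiableAt
    have h2 : HasDerivAt (fun w : ℂ => (t : ℂ) * w) t z := by
      simpa using (hasDerivAt_id z).const_mul (t : ℂ)
    have h3 := (h1.hasDerivAt.comp z h2).const_mul (k t)
    rw [mul_comm (t : ℂ) (deriv F _)]
    exact h3

/-- Termwise integration: each coefficient acquires a moment of `k`. Since `tⁿ ≤ 1`, the absolutely
convergent series at `‖z‖` times the integral of `‖k‖` is a majorant. -/
theorem hasSum_integral_scale {k : ℝ → ℂ} (hk : IntegrableOn k (Set.Ioo 0 1)) (a b c : ℂ) {z : ℂ}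
    (hz : ‖z‖ < 1) :
    HasSum (fun n => gaussCoef a b c n * (∫ t in Set.Ioo (0 : ℝ) 1, k t * t ^ n) * z ^ n)
      (∫ t in Set.Ioo (0 : ℝ) 1, k t * gaussF a b c (t * z)) := by
  have hint : ∀ n : ℕ, IntegrableOn (fun t : ℝ => k t * (t : ℂ) ^ n) (Set.Ioo 0 1) := fun n =>
    hk.mul_continuousOn_of_subset (K := Set.Icc 0 1) (by fun_prop) measurableSet_Ioo isCompact_Icc
      Set.Ioo_subset_Icc_self
  have h := hasSum_integral_of_summable_integral_norm
    (μ := volume.restrict (Set.Ioo (0 : ℝ) 1))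
    (F := fun (n : ℕ) (t : ℝ) => gaussCoef a b c n * z ^ n * (k t * (t : ℂ) ^ n))
    (fun n => (hint n).const_mul _) ?_
  · convert! h using 1
    · funext n
      rw [integral_const_mul]; ring
    · refine setIntegral_congr_fun measurableSet_Ioo fun t ht => ?_
      have htz : ‖(t : ℂ) * z‖ < 1 := by
        rw [norm_mul, Complex.norm_real, Real.norm_of_nonneg ht.1.le]
        nlinarith [ht.1, ht.2, norm_nonneg z]
      rw [gaussF_eq_of_norm_lt_one _ _ _ htz, ← (hasSum_gauss a b c htz).tsum_eq, ← tsum_mul_left]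
      refine tsum_congr fun n => ?_
      rw [mul_pow]; ring
  · refine Summable.of_nonneg_of_le (fun n => integral_nonneg fun t => norm_nonneg _) (fun n => ?_)
      ((summable_norm_gauss a b c (norm_nonneg z) hz).mul_right
        (∫ t in Set.Ioo (0 : ℝ) 1, ‖k t‖))
    rw [← integral_const_mul]
    refine setIntegral_mono_on (((hint n).const_mul _).norm) (hk.norm.const_mul _)
      measurableSet_Ioo fun t ht => ?_
    rw [norm_mul, norm_mul, norm_pow, norm_mul, norm_pow, Complex.norm_real,
      Real.norm_of_nonneg ht.1.le]
    refine mul_le_mul_of_nonneg_left ?_ (by positivity)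
    exact mul_le_of_le_one_right (norm_nonneg _) (pow_le_one₀ ht.1.le ht.2.le)

/-- The integrand of the beta integral. -/
def betaKer (s μ : ℂ) (t : ℝ) : ℂ := (t : ℂ) ^ (s - 1) * (1 - (t : ℂ)) ^ (μ - 1)

theorem integrableOn_betaKer {s μ : ℂ} (hs : 0 < s.re) (hμ : 0 < μ.re) :
    IntegrableOn (betaKer s μ) (Set.Ioo 0 1) :=
  (intervalIntegrable_iff_integrableOn_Ioo_of_le zero_le_one).1
    (Complex.betaIntegral_convergent hs hμ)

theorem integral_betaKer {s μ : ℂ} (hs : 0 < s.re) (hμ : 0 < μ.re) :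
    ∫ t in Set.Ioo (0 : ℝ) 1, betaKer s μ t =
      Complex.Gamma s * Complex.Gamma μ / Complex.Gamma (s + μ) := by
  rw [← Complex.betaIntegral_eq_Gamma_mul_div _ _ hs hμ, Complex.betaIntegral,
    intervalIntegral.integral_of_le zero_le_one, integral_Ioc_eq_integral_Ioo]
  rfl

theorem Gamma_add_nat {s : ℂ} (hs : 0 < s.re) (n : ℕ) :
    Complex.Gamma (s + n) = Complex.Gamma s * poch s n := by
  rw [poch, ← Complex.Gamma_add_nat_div_Gamma_eq s (notPole_of_re_pos hs),
    mul_div_cancel₀ _ (Complex.Gamma_ne_zero_of_re_pos hs)]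

/-- The factor `tⁿ` replaces `s` by `s + n` in the beta integral. -/
theorem integral_betaKer_mul_pow {s μ : ℂ} (hs : 0 < s.re) (hμ : 0 < μ.re) (n : ℕ) :
    ∫ t in Set.Ioo (0 : ℝ) 1, betaKer s μ t * (t : ℂ) ^ n =
      Complex.Gamma s * Complex.Gamma μ / Complex.Gamma (s + μ) * (poch s n / poch (s + μ) n) := by
  have hs' : 0 < (s + n).re := by
    simp only [Complex.add_re, Complex.natCast_re]; positivity
  have hsm : 0 < (s + μ).re := by simp only [Complex.add_re]; positivity
  have h := integral_betaKer hs' hμ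
  rw [show s + n + μ = s + μ + n by ring, Gamma_add_nat hs, Gamma_add_nat hsm] at h
  rw [div_mul_div_comm, mul_right_comm (Complex.Gamma s) _ (poch s n), ← h]
  refine setIntegral_congr_fun measurableSet_Ioo fun t ht => ?_
  have ht0 : (t : ℂ) ≠ 0 := by exact_mod_cast ht.1.ne'
  simp only [betaKer]
  rw [add_sub_right_comm, Complex.cpow_add _ _ ht0, Complex.cpow_natCast]
  ring

/-- Integration of the hypergeometric function against a beta kernel. -/
theorem integral_betaKer_mul_gaussF {a b c a' b' c' s μ : ℂ} (hc : NotPole c) (hs : 0 < s.re)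
    (hμ : 0 < μ.re)
    (h : ∀ n, gaussCoef a b c n * (poch s n / poch (s + μ) n) = gaussCoef a' b' c' n) {z : ℂ}
    (hz : z ∈ baseDom) :
    ∫ t in Set.Ioo (0 : ℝ) 1, betaKer s μ t * gaussF a b c (t * z) =
      Complex.Gamma s * Complex.Gamma μ / Complex.Gamma (s + μ) * gaussF a' b' c' z := by
  set B := Complex.Gamma s * Complex.Gamma μ / Complex.Gamma (s + μ) with hB
  have hsm : 0 < (s + μ).re := by simp only [Complex.add_re]; positivity
  have hB0 : B ≠ 0 := div_ne_zero (mul_ne_zero (Complex.Gamma_ne_zero_of_re_pos hs)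
    (Complex.Gamma_ne_zero_of_re_pos hμ)) (Complex.Gamma_ne_zero_of_re_pos hsm)
  have hk := integrableOn_betaKer hs hμ
  -- Both sides are analytic on `baseDom`, so the hypothesis on coefficients, which compares them in
  -- the disc, suffices.
  rw [gaussF_eq_of_analyticOnNhd (a := a') (b := b') (c := c')
    (f := fun z => B⁻¹ * ∫ t in Set.Ioo (0 : ℝ) 1, betaKer s μ t * gaussF a b c (t * z))
    (analyticOnNhd_const.mul (analyticOnNhd_integral_scale hk (analyticOnNhd_gaussF a b hc)))
    ?_ hz, mul_inv_cancel_left₀ hB0]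
  filter_upwards [Metric.ball_mem_nhds (0 : ℂ) one_pos] with z hz
  have hz' : ‖z‖ < 1 := by simpa using hz
  refine HasSum.unique ?_ (hasSum_gauss a' b' c' hz')
  refine ((hasSum_integral_scale hk a b c hz').mul_left B⁻¹).congr_fun fun n => ?_
  rw [integral_betaKer_mul_pow hs hμ, ← hB, ← h]
  field_simp

/-- With `s = c` the moment quotient `(c)ₙ/(c+μ)ₙ` exchanges the lower symbol for `(c+μ)ₙ`. -/
theorem integral_betaKer_cP (a b : ℂ) {c μ : ℂ} (hc : 0 < c.re) (hμ : 0 < μ.re) {z : ℂ}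
    (hz : z ∈ baseDom) :
    ∫ t in Set.Ioo (0 : ℝ) 1, betaKer c μ t * gaussF a b c (t * z) =
      Complex.Gamma c * Complex.Gamma μ / Complex.Gamma (c + μ) * gaussF a b (c + μ) z := by
  refine integral_betaKer_mul_gaussF (notPole_of_re_pos hc) hc hμ (fun n => ?_) hz
  have := (notPole_of_re_pos hc).poch_ne_zero n
  simp only [gaussCoef]
  field_simp

theorem integral_betaKer_aM {a b c μ : ℂ} (hc : NotPole c) (hμ : 0 < μ.re) (ha : μ.re < a.re)
    {z : ℂ} (hz : z ∈ baseDom) :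
    ∫ t in Set.Ioo (0 : ℝ) 1, betaKer (a - μ) μ t * gaussF a b c (t * z) =
      Complex.Gamma (a - μ) * Complex.Gamma μ / Complex.Gamma a * gaussF (a - μ) b c z := by
  have h := integral_betaKer_mul_gaussF (a := a) (b := b) (a' := a - μ) (b' := b) (c' := c)
    (s := a - μ) hc (by simpa using ha) hμ (fun n => ?_) hz
  · rwa [sub_add_cancel] at h
  · have := (notPole_of_re_pos (hμ.trans ha)).poch_ne_zero n
    have := hc.poch_ne_zero n
    rw [sub_add_cancel]
    simp only [gaussCoef]
    field_simp

/-! ### Powers of absolute values and changes of variable -/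

theorem absPow_mul (x y : ℝ) (s : ℂ) : absPow (x * y) s = absPow x s * absPow y s := by
  rw [absPow, abs_mul, Complex.ofReal_mul,
    Complex.mul_cpow_ofReal_nonneg (abs_nonneg x) (abs_nonneg y)]
  rfl

theorem absPow_add {x : ℝ} (hx : x ≠ 0) (s t : ℂ) : absPow x (s + t) = absPow x s * absPow x t :=
  Complex.cpow_add _ _ (by simpa using hx)

theorem absPow_sub {x : ℝ} (hx : x ≠ 0) (s t : ℂ) : absPow x (s - t) = absPow x s / absPow x t :=
  Complex.cpow_sub _ _ (by simpa using hx)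

theorem absPow_neg (x : ℝ) (s : ℂ) : absPow x (-s) = (absPow x s)⁻¹ := Complex.cpow_neg _ _

theorem absPow_inv (x : ℝ) (s : ℂ) : absPow x⁻¹ s = (absPow x s)⁻¹ := by
  rw [absPow, abs_inv, Complex.ofReal_inv, Complex.inv_cpow _ _ (by
    rw [Complex.arg_ofReal_of_nonneg (abs_nonneg x)]; exact Real.pi_pos.ne)]
  rfl

theorem absPow_div (x y : ℝ) (s : ℂ) : absPow (x / y) s = absPow x s / absPow y s := by
  rw [div_eq_mul_inv, absPow_mul, absPow_inv, div_eq_mul_inv]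

theorem absPow_one (x : ℝ) : absPow x 1 = (|x| : ℝ) := Complex.cpow_one _

theorem absPow_zero (x : ℝ) : absPow x 0 = 1 := Complex.cpow_zero _

theorem absPow_two (x : ℝ) : absPow x 2 = ((|x| : ℝ) : ℂ) ^ 2 := by
  simp [absPow]

theorem one_absPow (s : ℂ) : absPow 1 s = 1 := by simp [absPow]

theorem absPow_neg_left (x : ℝ) (s : ℂ) : absPow (-x) s = absPow x s := by simp [absPow]

theorem absPow_sub_comm (x y : ℝ) (s : ℂ) : absPow (x - y) s = absPow (y - x) s := by
  rw [← neg_sub, absPow_neg_left]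

theorem absPow_ne_zero {x : ℝ} (hx : x ≠ 0) (s : ℂ) : absPow x s ≠ 0 :=
  Complex.cpow_ne_zero_iff.2 (Or.inl (by simpa using hx))

theorem absPow_of_nonneg {x : ℝ} (hx : 0 ≤ x) (s : ℂ) : absPow x s = (x : ℂ) ^ s := by
  rw [absPow, abs_of_nonneg hx]

/-- All substitutions pass through this lemma. The factor `A` is constant in `y` and collects
whatever depends on `x` alone. -/
theorem HasFracInt.changeVar {I S : Set ℝ} {φ φ' : ℝ → ℝ} {g G : ℝ → ℂ} {μ R A : ℂ} {x X : ℝ}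
    (h : HasFracInt I G μ X R) (hS : MeasurableSet S)
    (hφ : ∀ y ∈ S, HasDerivAt φ (φ' y) y) (hinj : Set.InjOn φ S) (himg : φ '' S = I)
    (hg : ∀ y ∈ S, g y * absPow (x - y) (μ - 1) =
      A * (((|φ' y| : ℝ) : ℂ) * (G (φ y) * absPow (X - φ y) (μ - 1)))) :
    HasFracInt S g μ x (A * R) := by
  subst himg
  have hφ' : ∀ y ∈ S, HasDerivWithinAt φ (φ' y) S y := fun y hy => (hφ y hy).hasDerivWithinAt
  have heq : Set.EqOn (fun y => A * (|φ' y| •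
      (G (φ y) * (absPow (X - φ y) (μ - 1) / Complex.Gamma μ))))
      (fun y => g y * (absPow (x - y) (μ - 1) / Complex.Gamma μ)) S := by
    intro y hy
    have := hg y hy
    simp only [Complex.real_smul]
    rw [← mul_div_assoc (g y), this]
    ring
  obtain ⟨h1, h2⟩ := h
  rw [integrableOn_image_iff_integrableOn_abs_deriv_smul hS hφ' hinj] at h1
  rw [integral_image_eq_integral_abs_deriv_smul hS hφ' hinj] at h2
  refine ⟨IntegrableOn.congr_fun (h1.const_mul A) heq hS, ?_⟩
  rw [← setIntegral_congr_fun hS heq, integral_const_mul, h2]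

theorem HasFracInt.congr {S : Set ℝ} {g G : ℝ → ℂ} {μ R : ℂ} {x : ℝ} (h : HasFracInt S G μ x R)
    (hS : MeasurableSet S) (hg : ∀ y ∈ S, G y = g y) : HasFracInt S g μ x R := by
  have heq : Set.EqOn (fun y => G y * (absPow (x - y) (μ - 1) / Complex.Gamma μ))
      (fun y => g y * (absPow (x - y) (μ - 1) / Complex.Gamma μ)) S := fun y hy => by
    simp only [hg y hy]
  exact ⟨h.1.congr_fun heq hS, by rw [← setIntegral_congr_fun hS heq]; exact h.2⟩

theorem HasFracInt.congr_set {S I : Set ℝ} {g : ℝ → ℂ} {μ R : ℂ} {x : ℝ}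
    (h : HasFracInt S g μ x R) (hSI : S =ᵐ[volume] I) : HasFracInt I g μ x R :=
  ⟨h.1.congr_set_ae hSI.symm, by rw [← setIntegral_congr_set hSI]; exact h.2⟩

theorem measurableSet_between (x : ℝ) : MeasurableSet {y : ℝ | 0 < y / x ∧ y / x < 1} :=
  (measurableSet_lt (f := fun _ : ℝ => (0 : ℝ)) (g := fun y => y / x) (by fun_prop)
    (by fun_prop)).inter (measurableSet_lt (f := fun y => y / x) (g := fun _ => (1 : ℝ))
      (by fun_prop) (by fun_prop))

theorem between_lt_one {x y : ℝ} (hx : x < 1) (hy : 0 < y / x ∧ y / x < 1) : y < 1 ∧ y ≠ 0 := by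
  obtain ⟨h1, h2⟩ := hy
  refine ⟨?_, by rintro rfl; simp at h1⟩
  rcases lt_trichotomy x 0 with h | h | h
  · rw [div_pos_iff] at h1
    rcases h1 with h1 | h1 <;> linarith
  · simp [h] at h1
  · rw [div_lt_one h] at h2; linarith

theorem hasFracInt_betaKer {f : ℝ → ℂ} {s μ R : ℂ}
    (hf : IntegrableOn (fun t => betaKer s μ t * f t) (Set.Ioo 0 1))
    (hR : ∫ t in Set.Ioo (0 : ℝ) 1, betaKer s μ t * f t = R) :
    HasFracInt (Set.Ioo 0 1) (fun t => absPow t (s - 1) * f t) μ 1 (R / Complex.Gamma μ) := by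
  have heq : Set.EqOn (fun t => betaKer s μ t * f t / Complex.Gamma μ) (fun t => absPow t (s - 1) *
      f t * (absPow (1 - t) (μ - 1) / Complex.Gamma μ)) (Set.Ioo 0 1) := fun t ht => by
    simp only [betaKer]
    rw [absPow_of_nonneg ht.1.le, absPow_of_nonneg (by linarith [ht.2])]
    push_cast
    ring
  refine ⟨IntegrableOn.congr_fun (hf.div_const _) heq measurableSet_Ioo, ?_⟩
  rw [← setIntegral_congr_fun measurableSet_Ioo heq, integral_div, hR]

/-- The substitution `t = y/x` covers both signs of `x`; the exponent `s + μ - 1` adds up the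
weight, the kernel and the differential. -/
theorem HasFracInt.scale {f : ℝ → ℂ} {s μ R : ℂ} {x : ℝ} (hx : x ≠ 0)
    (h : HasFracInt (Set.Ioo 0 1) (fun t => absPow t (s - 1) * f (t * x)) μ 1 R) :
    HasFracInt {y | 0 < y / x ∧ y / x < 1} (fun y => absPow y (s - 1) * f y) μ x
      (absPow x (s + μ - 1) * R) := by
  refine h.changeVar (φ := fun y => y / x) (φ' := fun _ => 1 / x) (measurableSet_between x)
    (fun y _ => (hasDerivAt_id y).div_const x) (fun y _ z _ hyz => (div_left_inj' hx).1 hyz) ?_ ?_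
  · ext t
    simp only [Set.mem_image, Set.mem_ofPred_eq, Set.mem_Ioo]
    constructor
    · rintro ⟨y, hy, rfl⟩; exact hy
    · intro ht
      exact ⟨t * x, by rwa [mul_div_cancel_right₀ _ hx], by rw [mul_div_cancel_right₀ _ hx]⟩
  · intro y _
    have h1 : 1 - y / x = (x - y) / x := by field_simp
    have h2 : ((|1 / x| : ℝ) : ℂ) = (absPow x 1)⁻¹ := by
      rw [absPow_one, abs_div, abs_one, one_div, Complex.ofReal_inv]
    rw [div_mul_cancel₀ _ hx, h1, h2, absPow_div, absPow_div,
      show s + μ - 1 = (s - 1) + (μ - 1) + 1 by ring, absPow_add hx, absPow_add hx]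
    have := absPow_ne_zero hx (s - 1)
    have := absPow_ne_zero hx (μ - 1)
    have := absPow_ne_zero hx 1
    field_simp

/-! ### Formulas for the first solution between `0` and `x` -/

theorem hasFracInt_cP (a b : ℂ) {c μ : ℂ} {x : ℝ} (hc : 0 < c.re) (hμ : 0 < μ.re) (hx : x < 1)
    (hx0 : x ≠ 0) :
    HasFracInt {y | 0 < y / x ∧ y / x < 1} (fun y => absPow y (c - 1) * w₁ y a b c) μ x
      (Complex.Gamma c / Complex.Gamma (c + μ) *
        (absPow x (c + μ - 1) * w₁ x a b (c + μ))) := by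
  have hz := ofReal_mem_baseDom hx
  have h := HasFracInt.scale (f := fun y => w₁ y a b c) (s := c) hx0 (hasFracInt_betaKer ?_ ?_)
    (R := Complex.Gamma c * Complex.Gamma μ / Complex.Gamma (c + μ) * w₁ x a b (c + μ) /
      Complex.Gamma μ)
  · convert h using 1
    have := Complex.Gamma_ne_zero_of_re_pos hμ
    field_simp
  · simp only [w₁, Complex.ofReal_mul]
    exact integrableOn_scale (integrableOn_betaKer hc hμ)
      (analyticOnNhd_gaussF a b (notPole_of_re_pos hc)).continuousOn hz
  · simp only [w₁, Complex.ofReal_mul]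
    exact integral_betaKer_cP a b hc hμ hz

theorem hasFracInt_aM {a : ℂ} (b : ℂ) {c μ : ℂ} {x : ℝ} (hc : NotPole c) (hμ : 0 < μ.re)
    (ha : μ.re < a.re) (hx : x < 1) (hx0 : x ≠ 0) :
    HasFracInt {y | 0 < y / x ∧ y / x < 1} (fun y => absPow y (a - μ - 1) * w₁ y a b c) μ x
      (Complex.Gamma (a - μ) / Complex.Gamma a * (absPow x (a - 1) * w₁ x (a - μ) b c)) := by
  have hz := ofReal_mem_baseDom hx
  have h := HasFracInt.scale (f := fun y => w₁ y a b c) (s := a - μ) hx0 (hasFracInt_betaKer ?_ ?_)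
    (R := Complex.Gamma (a - μ) * Complex.Gamma μ / Complex.Gamma a * w₁ x (a - μ) b c /
      Complex.Gamma μ)
  · convert h using 1
    have := Complex.Gamma_ne_zero_of_re_pos hμ
    rw [sub_add_cancel]
    field_simp
  · simp only [w₁, Complex.ofReal_mul]
    exact integrableOn_scale (integrableOn_betaKer (by simpa using ha) hμ)
      (analyticOnNhd_gaussF a b hc).continuousOn hz
  · simp only [w₁, Complex.ofReal_mul]
    exact integral_betaKer_aM hc hμ ha hz

theorem w₁_symm (x : ℝ) (a b c : ℂ) : w₁ x a b c = w₁ x b a c := gaussF_symm _ _ _ _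

theorem w₁_euler (a b : ℂ) {c : ℂ} (hc : NotPole c) {x : ℝ} (hx : x < 1) :
    w₁ x a b c = absPow (1 - x) (c - a - b) * w₁ x (c - a) (c - b) c := by
  rw [absPow_of_nonneg (by linarith)]
  exact gaussF_euler a b hc hx

theorem w₁_pfaff (a b : ℂ) {c : ℂ} (hc : NotPole c) {x : ℝ} (hx : x < 1) :
    w₁ x a b c = absPow (1 - x) (-a) * w₁ (x / (x - 1)) a (c - b) c := by
  rw [absPow_of_nonneg (by linarith)]
  exact gaussF_pfaff a b hc hx

/-- Read this way, Euler's transformation absorbs the weight `|1-y|^(a+b-c)`. It turns the types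
`a+,b+,c+`, `a+` and `c-` into `c+`, `a-` and `a-,b-,c-` at `(c-a, c-b, c)`. -/
theorem absPow_mul_w₁_euler (a b : ℂ) {c : ℂ} (hc : NotPole c) {x : ℝ} (hx : x < 1) :
    absPow (1 - x) (a + b - c) * w₁ x a b c = w₁ x (c - a) (c - b) c := by
  have hx' : 1 - x ≠ 0 := by linarith
  rw [w₁_euler a b hc hx, ← mul_assoc, ← absPow_add hx', show a + b - c + (c - a - b) = 0 by ring,
    absPow_zero, one_mul]

theorem hasFracInt_aPbPcP (a b : ℂ) {c μ : ℂ} {x : ℝ} (hc : 0 < c.re) (hμ : 0 < μ.re) (hx : x < 1)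
    (hx0 : x ≠ 0) :
    HasFracInt {y | 0 < y / x ∧ y / x < 1}
      (fun y => absPow y (c - 1) * absPow (1 - y) (a + b - c) * w₁ y a b c) μ x
      (Complex.Gamma c / Complex.Gamma (c + μ) *
        (absPow x (c + μ - 1) * absPow (1 - x) (a + b - c + μ) *
          w₁ x (a + μ) (b + μ) (c + μ))) := by
  have hcμ : NotPole (c + μ) := notPole_of_re_pos (by simp only [Complex.add_re]; linarith)
  have h := absPow_mul_w₁_euler (a + μ) (b + μ) hcμ hx
  rw [show a + μ + (b + μ) - (c + μ) = a + b - c + μ by ring, add_sub_add_right_eq_sub,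
    add_sub_add_right_eq_sub] at h
  rw [mul_assoc (absPow x _), h]
  refine (hasFracInt_cP (c - a) (c - b) hc hμ hx hx0).congr (measurableSet_between x)
    fun y hy => ?_
  rw [mul_assoc, absPow_mul_w₁_euler a b (notPole_of_re_pos hc) (between_lt_one hx hy).1]

theorem hasFracInt_aP (a b : ℂ) {c μ : ℂ} {x : ℝ} (hc : NotPole c) (hμ : 0 < μ.re)
    (ha : μ.re < (c - a).re) (hx : x < 1) (hx0 : x ≠ 0) :
    HasFracInt {y | 0 < y / x ∧ y / x < 1}
      (fun y => absPow y (c - a - μ - 1) * absPow (1 - y) (a + b - c) * w₁ y a b c) μ x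
      (Complex.Gamma (c - a - μ) / Complex.Gamma (c - a) *
        (absPow x (c - a - 1) * absPow (1 - x) (a + b - c + μ) * w₁ x (a + μ) b c)) := by
  have h := absPow_mul_w₁_euler (a + μ) b hc hx
  rw [show a + μ + b - c = a + b - c + μ by ring, ← sub_sub] at h
  rw [mul_assoc (absPow x _), h]
  refine (hasFracInt_aM (c - b) hc hμ ha hx hx0).congr (measurableSet_between x) fun y hy => ?_
  rw [mul_assoc, absPow_mul_w₁_euler a b hc (between_lt_one hx hy).1]

theorem div_sub_one_sub_div_sub_one {x y : ℝ} (hx : x < 1) (hy : y < 1) :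
    x / (x - 1) - y / (y - 1) = -((x - y) / ((1 - x) * (1 - y))) := by
  have h1 : x - 1 ≠ 0 := by linarith
  have h2 : y - 1 ≠ 0 := by linarith
  have h3 : 1 - x ≠ 0 := by linarith
  have h4 : 1 - y ≠ 0 := by linarith
  field_simp
  ring

theorem div_sub_one_involutive {x : ℝ} (hx : x < 1) : x / (x - 1) / (x / (x - 1) - 1) = x := by
  have h1 : x - 1 ≠ 0 := by linarith
  have : x / (x - 1) - 1 = (x - 1)⁻¹ := by field_simp; ring
  rw [this]; field_simp

theorem div_sub_one_lt_iff {x y : ℝ} (hx : x < 1) (hy : y < 1) :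
    x / (x - 1) < y / (y - 1) ↔ y < x := by
  rw [← sub_neg, div_sub_one_sub_div_sub_one hx hy, neg_neg_iff_pos,
    div_pos_iff_of_pos_right (mul_pos (by linarith) (by linarith)), sub_pos]

theorem image_div_sub_one {P Q : Set ℝ} (hP : P ⊆ Set.Iio 1) (hQ : Q ⊆ Set.Iio 1)
    (h : ∀ y < 1, y ∈ P ↔ y / (y - 1) ∈ Q) : (fun y => y / (y - 1)) '' P = Q := by
  ext t
  constructor
  · rintro ⟨y, hy, rfl⟩
    exact (h y (hP hy)).1 hy
  · intro ht
    have ht1 := hQ ht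
    refine ⟨t / (t - 1), (h _ (div_sub_one_lt_one ht1)).2 ?_, div_sub_one_involutive ht1⟩
    rwa [div_sub_one_involutive ht1]

theorem image_div_sub_one_between {x : ℝ} (hx : x < 1) (hx0 : x ≠ 0) :
    (fun y => y / (y - 1)) '' {y | 0 < y / x ∧ y / x < 1} =
      {t | 0 < t / (x / (x - 1)) ∧ t / (x / (x - 1)) < 1} := by
  refine image_div_sub_one (fun y hy => (between_lt_one hx hy).1)
    (fun y hy => (between_lt_one (div_sub_one_lt_one hx) hy).1) fun y hy => ?_
  have h1 : 0 < 1 - x := by linarith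
  have h2 : 0 < 1 - y := by linarith
  have h3 : x - 1 ≠ 0 := by linarith
  have h4 : y - 1 ≠ 0 := by linarith
  have e : y / (y - 1) / (x / (x - 1)) = y / x * ((1 - x) / (1 - y)) := by
    field_simp
    ring
  have e2 : y / x * ((1 - x) / (1 - y)) - 1 = (y / x - 1) / (1 - y) := by
    field_simp
    ring
  simp only [Set.mem_ofPred_eq]
  rw [e, mul_pos_iff_of_pos_right (div_pos h1 h2), ← sub_neg (a := _ * _), e2,
    div_neg_iff, ← sub_neg (a := y / x)]
  have := h2.le.not_gt
  tauto

theorem hasDerivAt_div_sub_one {y : ℝ} (hy : y < 1) :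
    HasDerivAt (fun y : ℝ => y / (y - 1)) (-1 / (1 - y) ^ 2) y := by
  have h1 : y - 1 ≠ 0 := by linarith
  have h := (hasDerivAt_id y).div ((hasDerivAt_id y).sub_const 1) h1
  convert! h using 1
  have h2 : 1 - y ≠ 0 := by linarith
  simp only [id]
  rw [← neg_sub y 1]
  field_simp
  ring

/-- For `t = y/(y-1)` the difference of two points is divided by `(1-x)(1-y)` up to sign, and
`|dt/dy| = |1-y|^(-2)`. Hence the exponents `-μ - 1 = -(μ-1) - 2` in `y` and `μ - 1` in `x`. -/
theorem HasFracInt.pfaff {P Q : Set ℝ} {g G : ℝ → ℂ} {μ R : ℂ} {x : ℝ} (hx : x < 1)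
    (h : HasFracInt Q G μ (x / (x - 1)) R) (hP : P ⊆ Set.Iio 1) (hPm : MeasurableSet P)
    (hPQ : (fun y => y / (y - 1)) '' P = Q)
    (hg : ∀ y ∈ P, g y = absPow (1 - y) (-μ - 1) * G (y / (y - 1))) :
    HasFracInt P g μ x (absPow (1 - x) (μ - 1) * R) := by
  refine h.changeVar hPm (fun y hy => hasDerivAt_div_sub_one (hP hy)) ?_ hPQ ?_
  · intro y hy z hz hyz
    rw [← div_sub_one_involutive (hP hy), ← div_sub_one_involutive (hP hz)]
    simp only at hyz
    rw [hyz]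
  · intro y hy
    have h1 : 1 - x ≠ 0 := by linarith
    have h2 : 1 - y ≠ 0 := by have := hP hy; simp only [Set.mem_Iio] at this; linarith
    have e : ((|(-1 / (1 - y) ^ 2)| : ℝ) : ℂ) = (absPow (1 - y) 2)⁻¹ := by
      rw [absPow_two, abs_div, abs_pow, abs_neg, abs_one, one_div]
      push_cast
      rfl
    rw [hg y hy, e, div_sub_one_sub_div_sub_one hx (hP hy), absPow_neg_left, absPow_div, absPow_mul,
      show -μ - 1 = -(μ - 1) - 2 by ring, absPow_sub h2 (-(μ - 1)), absPow_neg]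
    have := absPow_ne_zero h1 (μ - 1)
    have := absPow_ne_zero h2 (μ - 1)
    have := absPow_ne_zero h2 2
    field_simp

/-- Type `c+` at `(b, c-a, c)`, transported by Pfaff's transformation in the parameter `b`. As `c -
a` stays fixed, raising `c` raises `a` as well. -/
theorem hasFracInt_aPcP (a b : ℂ) {c μ : ℂ} {x : ℝ} (hc : 0 < c.re) (hμ : 0 < μ.re) (hx : x < 1)
    (hx0 : x ≠ 0) :
    HasFracInt {y | 0 < y / x ∧ y / x < 1}
      (fun y => absPow y (c - 1) * absPow (1 - y) (b - c - μ) * w₁ y a b c) μ x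
      (Complex.Gamma c / Complex.Gamma (c + μ) *
        (absPow x (c + μ - 1) * absPow (1 - x) (b - c) * w₁ x (a + μ) b (c + μ))) := by
  have hcμ : NotPole (c + μ) := notPole_of_re_pos (by simp only [Complex.add_re]; linarith)
  have h := HasFracInt.pfaff hx (P := {y | 0 < y / x ∧ y / x < 1})
    (g := fun y => absPow y (c - 1) * absPow (1 - y) (b - c - μ) * w₁ y a b c)
    (hasFracInt_cP b (c - a) hc hμ (div_sub_one_lt_one hx) (div_ne_zero hx0 (by linarith)))
    (fun y hy => (between_lt_one hx hy).1) (measurableSet_between x)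
    (image_div_sub_one_between hx hx0) ?_
  · convert h using 1
    have h1 : 1 - x ≠ 0 := by linarith
    rw [w₁_symm x, w₁_pfaff b (a + μ) hcμ hx, add_sub_add_right_eq_sub, absPow_div,
      absPow_sub_comm x 1, show c + μ - 1 = c + (μ - 1) by ring, absPow_sub h1 b c, absPow_neg,
      absPow_add h1]
    have := absPow_ne_zero h1 b
    have := absPow_ne_zero h1 c
    have := absPow_ne_zero h1 (μ - 1)
    field_simp
  · intro y hy
    have hy1 := (between_lt_one hx hy).1
    have h1 : 1 - y ≠ 0 := by linarith
    rw [w₁_symm y, w₁_pfaff b a (notPole_of_re_pos hc) hy1, absPow_div, absPow_sub_comm y 1,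
      show b - c - μ = b - (c - 1) + (-μ - 1) by ring, absPow_add h1, absPow_sub h1, absPow_neg]
    have := absPow_ne_zero h1 b
    have := absPow_ne_zero h1 (c - 1)
    field_simp

/-! ### Formulas for the first solution on `(-∞,x)` and `(x,1)` -/

theorem measurable_absPow (s : ℂ) : Measurable fun x : ℝ => absPow x s := by
  unfold absPow; fun_prop

theorem measurable_betaKer (s μ : ℂ) : Measurable (betaKer s μ) := by
  unfold betaKer; fun_prop

theorem ofReal_norm_absPow {x : ℝ} (hx : x ≠ 0) (s : ℂ) :
    ((‖absPow x s‖ : ℝ) : ℂ) = absPow x (s.re : ℂ) := by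
  rw [absPow, Complex.norm_cpow_eq_rpow_re_of_pos (abs_pos.2 hx),
    Complex.ofReal_cpow (abs_nonneg x)]
  rfl

theorem norm_absPow {x : ℝ} (hx : x ≠ 0) (s : ℂ) : ‖absPow x s‖ = ‖absPow x (s.re : ℂ)‖ := by
  rw [← ofReal_norm_absPow hx, Complex.norm_real, norm_norm]

theorem one_sub_mul_pos {x t : ℝ} (hx : x < 1) (ht : 0 < t) (ht1 : t < 1) : 0 < 1 - x * t := by
  nlinarith

theorem image_one_sub_div {x t : ℝ} (ht : 0 < t) (hxt : 0 < 1 - x * t) :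
    (fun y => (1 - x * t) / (1 - y * t)) '' Set.Iio x = Set.Ioo 0 1 := by
  ext u
  simp only [Set.mem_image, Set.mem_Iio, Set.mem_Ioo]
  constructor
  · rintro ⟨y, hy, rfl⟩
    have h1 : 1 - x * t < 1 - y * t := by nlinarith
    exact ⟨div_pos hxt (hxt.trans h1), (div_lt_one (hxt.trans h1)).2 h1⟩
  · rintro ⟨h0, h1⟩
    refine ⟨(1 - (1 - x * t) / u) / t, ?_, ?_⟩
    · rw [div_lt_iff₀ ht]
      have : 1 - x * t < (1 - x * t) / u := by rw [lt_div_iff₀ h0]; nlinarith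
      linarith
    · rw [div_mul_cancel₀ _ ht.ne', sub_sub_cancel]
      field_simp

/-- The fractional integral of a power of a linear function over a half-line. -/
theorem hasFracInt_one_sub_mul {a μ : ℂ} {x t : ℝ} (hμ : 0 < μ.re) (ha : μ.re < a.re) (ht : 0 < t)
    (hxt : 0 < 1 - x * t) :
    HasFracInt (Set.Iio x) (fun y => absPow (1 - y * t) (-a)) μ x
      (absPow t (-μ) * absPow (1 - x * t) (μ - a) *
        (Complex.Gamma (a - μ) / Complex.Gamma a)) := by
  have haμ : 0 < (a - μ).re := by simpa using ha
  have hker := integral_betaKer haμ hμ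
  rw [sub_add_cancel] at hker
  have h := hasFracInt_betaKer (f := fun _ => 1) (s := a - μ) (μ := μ)
    (R := Complex.Gamma (a - μ) * Complex.Gamma μ / Complex.Gamma a)
    (by simpa using integrableOn_betaKer haμ hμ) (by simpa using hker)
  have hR : Complex.Gamma (a - μ) * Complex.Gamma μ / Complex.Gamma a / Complex.Gamma μ =
      Complex.Gamma (a - μ) / Complex.Gamma a := by
    have := Complex.Gamma_ne_zero_of_re_pos hμ
    field_simp
  rw [hR] at h
  have hpos : ∀ y ∈ Set.Iio x, 0 < 1 - y * t := fun y hy => by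
    have : y < x := hy
    nlinarith
  -- For `u = (1-xt)/(1-yt)` one has `1 - u = t(x-y)/(1-yt)`, so the integral becomes the beta
  -- integral with parameters `a - μ` and `μ`.
  refine h.changeVar (φ := fun y => (1 - x * t) / (1 - y * t))
    (φ' := fun y => (1 - x * t) * t / (1 - y * t) ^ 2) measurableSet_Iio ?_ ?_
    (image_one_sub_div ht hxt) ?_
  · intro y hy
    have h1 := (hpos y hy).ne'
    have h2 := (hasDerivAt_const y (1 - x * t)).fun_div
      (((hasDerivAt_id y).mul_const t).const_sub 1) h1
    convert! h2 using 1
    simp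
  · intro y hy z hz hyz
    have h1 := (hpos y hy).ne'
    have h2 := (hpos z hz).ne'
    simp only at hyz
    rw [div_eq_div_iff h1 h2] at hyz
    have := mul_left_cancel₀ hxt.ne' hyz
    exact mul_right_cancel₀ ht.ne' (by linarith)
  · intro y hy
    have h1 := (hpos y hy).ne'
    have h2 := hxt.ne'
    have e1 : 1 - (1 - x * t) / (1 - y * t) = t * (x - y) / (1 - y * t) := by
      rw [eq_div_iff h1, sub_mul, div_mul_cancel₀ _ h1]; ring
    have e2 : ((|(1 - x * t) * t / (1 - y * t) ^ 2| : ℝ) : ℂ) =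
        absPow (1 - x * t) 1 * absPow t 1 / absPow (1 - y * t) 2 := by
      rw [absPow_two, absPow_one, absPow_one, abs_div, abs_pow, abs_mul]
      push_cast
      rfl
    rw [e1, e2, absPow_div, absPow_div, absPow_mul, show a - μ - 1 = a - (μ - 1) - 2 by ring,
      show -μ = -(μ - 1) - 1 by ring, show μ - a = -(a - (μ - 1) - 1) by ring]
    generalize 1 - x * t = P at *
    generalize 1 - y * t = Q at *
    simp only [absPow_neg, absPow_sub h1, absPow_sub h2, absPow_sub ht.ne']
    have := absPow_ne_zero h1 a
    have := absPow_ne_zero h1 (μ - 1)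
    have := absPow_ne_zero h1 μ
    have := absPow_ne_zero h1 1
    have := absPow_ne_zero h1 2
    have := absPow_ne_zero ht.ne' μ
    have := absPow_ne_zero ht.ne' 1
    have := absPow_ne_zero h2 a
    have := absPow_ne_zero h2 1
    have := absPow_ne_zero h2 2
    have := absPow_ne_zero h2 μ
    have e3 : absPow P 2 = absPow P 1 * absPow P 1 := by
      rw [← absPow_add h2]; norm_num
    rw [e3]
    field_simp

/-- Taking moduli replaces `a` and `μ` by their real parts, so the previous formula also evaluates
the absolute integral, as Fubini requires. The factor `Γ(Re μ)` undoes the normalisation of the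
kernel. -/
theorem integral_norm_one_sub_mul {a μ : ℂ} {x t : ℝ} (hμ : 0 < μ.re) (ha : μ.re < a.re)
    (ht : 0 < t) (hxt : 0 < 1 - x * t) :
    ∫ y in Set.Iio x, ‖absPow (1 - y * t) (-a)‖ * ‖absPow (x - y) (μ - 1)‖ =
      ‖absPow t (-μ) * absPow (1 - x * t) (μ - a)‖ *
        ‖Complex.Gamma μ.re * (Complex.Gamma (a.re - μ.re) / Complex.Gamma a.re)‖ := by
  have hG := Complex.Gamma_ne_zero_of_re_pos (s := (μ.re : ℂ)) (by simpa using hμ)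
  have h := (hasFracInt_one_sub_mul (a := (a.re : ℂ)) (μ := (μ.re : ℂ)) (by simpa using hμ)
    (by simpa using ha) ht hxt).2
  have h2 : ((∫ y in Set.Iio x, ‖absPow (1 - y * t) (-a)‖ * ‖absPow (x - y) (μ - 1)‖ : ℝ) : ℂ) =
      absPow t (-(μ.re : ℂ)) * absPow (1 - x * t) (μ.re - a.re) *
        (Complex.Gamma μ.re * (Complex.Gamma (a.re - μ.re) / Complex.Gamma a.re)) := by
    rw [← mul_assoc, mul_right_comm _ (Complex.Gamma μ.re), ← h, ← integral_mul_const,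
      ← integral_complex_ofReal]
    refine setIntegral_congr_fun measurableSet_Iio fun y hy => ?_
    have hy' : y < x := hy
    have h1 : 1 - y * t ≠ 0 := by nlinarith
    have h3 : x - y ≠ 0 := by linarith
    rw [Complex.ofReal_mul, ofReal_norm_absPow h1, ofReal_norm_absPow h3]
    simp only [Complex.neg_re, Complex.sub_re, Complex.one_re]
    push_cast
    field_simp
  have h3 : 0 ≤ ∫ y in Set.Iio x, ‖absPow (1 - y * t) (-a)‖ * ‖absPow (x - y) (μ - 1)‖ :=
    integral_nonneg fun y => by positivity
  rw [← Real.norm_of_nonneg h3, ← Complex.norm_real, h2, norm_mul, norm_mul,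
    norm_mul (absPow t (-μ)), norm_absPow ht.ne' (-μ), norm_absPow hxt.ne' (μ - a)]
  simp

/-- Euler's integral representation. -/
theorem w₁_eq_integral (a : ℂ) {b c : ℂ} {y : ℝ} (hb : 0 < b.re) (hbc : b.re < c.re) (hy : y < 1) :
    w₁ y a b c = Complex.Gamma c / (Complex.Gamma b * Complex.Gamma (c - b)) *
      ∫ t in Set.Ioo (0 : ℝ) 1, betaKer b (c - b) t * absPow (1 - y * t) (-a) := by
  have hcb : 0 < (c - b).re := by simpa using hbc
  -- Euler's integral is the `c+` formula that raises the lower parameter from `b` to `c`, starting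
  -- from `F(a,b;b;z) = (1-z)^(-a)`.
  have h := integral_betaKer_cP a b hb hcb (ofReal_mem_baseDom hy)
  rw [add_sub_cancel] at h
  have g1 := Complex.Gamma_ne_zero_of_re_pos hb
  have g2 := Complex.Gamma_ne_zero_of_re_pos hcb
  have g3 := Complex.Gamma_ne_zero_of_re_pos (hb.trans hbc)
  have h2 : ∫ t in Set.Ioo (0 : ℝ) 1, betaKer b (c - b) t * absPow (1 - y * t) (-a) =
      ∫ t in Set.Ioo (0 : ℝ) 1, betaKer b (c - b) t * gaussF a b b (t * y) := by
    refine setIntegral_congr_fun measurableSet_Ioo fun t ht => ?_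
    have h1 := one_sub_mul_pos hy ht.1 ht.2
    have h3 : gaussF a b b (t * y) = absPow (1 - y * t) (-a) := by
      rw [← Complex.ofReal_mul, mul_comm, gaussF_self a (notPole_of_re_pos hb) (by linarith),
        absPow_of_nonneg h1.le]
    simp only [h3]
  rw [h2, h, w₁]
  field_simp

theorem continuousOn_absPow_one_sub_mul (s : ℂ) {x : ℝ} (hx : x < 1) :
    ContinuousOn (fun t : ℝ => absPow (1 - x * t) s) (Set.Icc 0 1) := by
  intro t ht
  have h1 : 0 < 1 - x * t := by
    rcases le_or_gt x 0 with h | h <;> nlinarith [ht.1, ht.2]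
  refine ContinuousAt.continuousWithinAt ?_
  unfold absPow
  refine ContinuousAt.cpow (by fun_prop) continuousAt_const (Or.inl ?_)
  simpa using h1.ne'

theorem betaKer_mul_absPow (s ν μ : ℂ) {t : ℝ} (ht : 0 < t) :
    betaKer s ν t * absPow t (-μ) = betaKer (s - μ) ν t := by
  have ht0 : (t : ℂ) ≠ 0 := by exact_mod_cast ht.ne'
  rw [betaKer, betaKer, absPow_of_nonneg ht.le, show s - μ - 1 = s - 1 + -μ by ring,
    Complex.cpow_add _ _ ht0]
  ring

/-- Insert Euler's integral for `w₁`, which needs `Re b < Re c`, and integrate over `y` first. The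
resulting `t^(-μ)` lowers `b` in the beta kernel while `c - b` is unchanged, leaving Euler's
integral at `(a-μ, b-μ, c-μ)`. -/
theorem hasFracInt_aMbMcM_of_lt {a b c μ : ℂ} {x : ℝ} (hμ : 0 < μ.re) (ha : μ.re < a.re)
    (hb : μ.re < b.re) (hbc : b.re < c.re) (hx : x < 1) :
    HasFracInt (Set.Iio x) (fun y => w₁ y a b c) μ x
      (Complex.Gamma (a - μ) / Complex.Gamma a * (Complex.Gamma (b - μ) / Complex.Gamma b) *
        (Complex.Gamma c / Complex.Gamma (c - μ)) * w₁ x (a - μ) (b - μ) (c - μ)) := by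
  have hcb : 0 < (c - b).re := by simpa using hbc
  have hbμ : 0 < (b - μ).re := by simpa using hb
  set f : ℝ × ℝ → ℂ := fun p => betaKer b (c - b) p.2 * (absPow (1 - p.1 * p.2) (-a) *
    (absPow (x - p.1) (μ - 1) / Complex.Gamma μ)) with hf
  set g : ℝ → ℂ := fun t => betaKer (b - μ) (c - b) t * absPow (1 - x * t) (μ - a) with hg
  set K := Complex.Gamma c / (Complex.Gamma b * Complex.Gamma (c - b)) with hK
  have hgint : IntegrableOn g (Set.Ioo 0 1) :=
    (integrableOn_betaKer hbμ hcb).mul_continuousOn_of_subset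
      (continuousOn_absPow_one_sub_mul _ hx) measurableSet_Ioo isCompact_Icc
      Set.Ioo_subset_Icc_self
  have hfm : Measurable f := by
    refine ((measurable_betaKer _ _).comp measurable_snd).mul
      (((measurable_absPow _).comp ?_).mul ((((measurable_absPow _).comp ?_)).div_const _))
    · fun_prop
    · fun_prop
  have hfint : Integrable f
      ((volume.restrict (Set.Iio x)).prod (volume.restrict (Set.Ioo 0 1))) := by
    -- The `y`-integral of `‖f‖` is a constant multiple of `‖g t‖`, which is integrable because `Re
    -- (b-μ) > 0`.
    rw [integrable_prod_iff' hfm.aestronglyMeasurable]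
    constructor
    · filter_upwards [ae_restrict_mem measurableSet_Ioo] with t ht
      exact (hasFracInt_one_sub_mul hμ ha ht.1 (one_sub_mul_pos hx ht.1 ht.2)).1.const_mul
        (betaKer b (c - b) t)
    · refine IntegrableOn.congr_fun (hgint.norm.mul_const
        (‖Complex.Gamma μ.re * (Complex.Gamma (a.re - μ.re) / Complex.Gamma a.re)‖ /
          ‖Complex.Gamma μ‖)) (fun t ht => ?_) measurableSet_Ioo
      have h1 := integral_norm_one_sub_mul hμ ha ht.1 (one_sub_mul_pos hx ht.1 ht.2)
      simp only [hf, hg, norm_mul, norm_div]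
      rw [integral_const_mul]
      simp only [← mul_div_assoc]
      rw [integral_div, h1, ← betaKer_mul_absPow _ _ _ ht.1]
      simp only [norm_mul, norm_div]
      ring
  have hinner : ∀ y ∈ Set.Iio x, ∫ t in Set.Ioo (0 : ℝ) 1, f (y, t) =
      K⁻¹ * (w₁ y a b c * (absPow (x - y) (μ - 1) / Complex.Gamma μ)) := by
    intro y hy
    have hy1 : y < 1 := lt_trans hy hx
    have hK0 : K ≠ 0 := div_ne_zero (Complex.Gamma_ne_zero_of_re_pos (by linarith))
      (mul_ne_zero (Complex.Gamma_ne_zero_of_re_pos (by linarith))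
        (Complex.Gamma_ne_zero_of_re_pos hcb))
    rw [w₁_eq_integral a (hμ.trans hb) hbc hy1, ← hK, mul_assoc, inv_mul_cancel_left₀ hK0,
      ← integral_mul_const]
    refine integral_congr_ae (Eventually.of_forall fun t => ?_)
    simp only [hf]
    ring
  have hK0 : K ≠ 0 := div_ne_zero (Complex.Gamma_ne_zero_of_re_pos (by linarith))
    (mul_ne_zero (Complex.Gamma_ne_zero_of_re_pos (by linarith))
      (Complex.Gamma_ne_zero_of_re_pos hcb))
  have hcongr : Set.EqOn (fun y => K * ∫ t in Set.Ioo (0 : ℝ) 1, f (y, t))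
      (fun y => w₁ y a b c * (absPow (x - y) (μ - 1) / Complex.Gamma μ)) (Set.Iio x) :=
    fun y hy => by
      simp only [hinner y hy]
      rw [mul_inv_cancel_left₀ hK0]
  refine ⟨IntegrableOn.congr_fun (hfint.integral_prod_left.const_mul K) hcongr
    measurableSet_Iio, ?_⟩
  rw [← setIntegral_congr_fun measurableSet_Iio hcongr, integral_const_mul,
    integral_integral_swap (f := fun y t => f (y, t)) hfint]
  have hout : ∫ t in Set.Ioo (0 : ℝ) 1, ∫ y in Set.Iio x, f (y, t) =
      ∫ t in Set.Ioo (0 : ℝ) 1, g t * (Complex.Gamma (a - μ) / Complex.Gamma a) := by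
    refine setIntegral_congr_fun measurableSet_Ioo fun t ht => ?_
    have h1 := (hasFracInt_one_sub_mul hμ ha ht.1 (one_sub_mul_pos hx ht.1 ht.2)).2
    simp only [hf, hg]
    rw [integral_const_mul, h1, ← betaKer_mul_absPow _ _ _ ht.1]
    ring
  have hcb' : c - μ - (b - μ) = c - b := by ring
  have he := w₁_eq_integral (a - μ) (c := c - μ) hbμ (by simpa using hbc) hx
  rw [hcb', neg_sub] at he
  rw [hout, integral_mul_const, he]
  have g1 := Complex.Gamma_ne_zero_of_re_pos hbμ
  have g2 := Complex.Gamma_ne_zero_of_re_pos hcb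
  have g3 : Complex.Gamma (c - μ) ≠ 0 := Complex.Gamma_ne_zero_of_re_pos (by
    simp only [Complex.sub_re]; linarith)
  simp only [hK, hg]
  field_simp

theorem HasFracInt.add {S : Set ℝ} {g h : ℝ → ℂ} {μ R R' : ℂ} {x : ℝ} (hg : HasFracInt S g μ x R)
    (hh : HasFracInt S h μ x R') (α β : ℂ) :
    HasFracInt S (fun y => α * g y + β * h y) μ x (α * R + β * R') := by
  have heq : (fun y => (α * g y + β * h y) * (absPow (x - y) (μ - 1) / Complex.Gamma μ)) =
      fun y => α * (g y * (absPow (x - y) (μ - 1) / Complex.Gamma μ)) +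
        β * (h y * (absPow (x - y) (μ - 1) / Complex.Gamma μ)) := by
    funext y; ring
  rw [HasFracInt, heq]
  refine ⟨(hg.1.const_mul α).add (hh.1.const_mul β), ?_⟩
  rw [integral_add (hg.1.const_mul α) (hh.1.const_mul β), integral_const_mul, integral_const_mul,
    hg.2, hh.2]

theorem w₁_contiguous (a b : ℂ) {c : ℂ} (hc : NotPole c) {x : ℝ} (hx : x < 1) :
    w₁ x a b c = a / c * w₁ x (a + 1) b (c + 1) + (c - a) / c * w₁ x a b (c + 1) := by
  have h := gaussF_contiguous a b hc (ofReal_mem_baseDom hx)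
  have := hc.ne_zero
  simp only [w₁]
  field_simp
  linear_combination h

/-- Induction on a bound `n` for `Re b - Re c`. The contiguous relation expresses `F(a,b;c)` through
functions with `c + 1`, the same `b`, and `a` or `a + 1`, so the other conditions persist. -/
theorem hasFracInt_aMbMcM {a b c μ : ℂ} {x : ℝ} (hμ : 0 < μ.re) (ha : μ.re < a.re)
    (hb : μ.re < b.re) (hc : NotPole c) (hcμ : NotPole (c - μ)) (hx : x < 1) :
    HasFracInt (Set.Iio x) (fun y => w₁ y a b c) μ x
      (Complex.Gamma (a - μ) / Complex.Gamma a * (Complex.Gamma (b - μ) / Complex.Gamma b) *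
        (Complex.Gamma c / Complex.Gamma (c - μ)) * w₁ x (a - μ) (b - μ) (c - μ)) := by
  obtain ⟨n, hn⟩ := exists_nat_gt (b.re - c.re)
  induction n generalizing a c with
  | zero =>
    exact hasFracInt_aMbMcM_of_lt hμ ha hb (by simpa using hn) hx
  | succ n ih =>
    have hn' : b.re - (c + 1).re < n := by
      push_cast at hn
      simp only [Complex.add_re, Complex.one_re]
      linarith
    have e1 : c + 1 - μ = c - μ + 1 := by ring
    have e2 : a + 1 - μ = a - μ + 1 := by ring
    have h1 := ih (a := a + 1) (c := c + 1)
      (by simp only [Complex.add_re, Complex.one_re]; linarith) hc.add_one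
      (by rw [e1]; exact hcμ.add_one) hn'
    have h2 := ih (a := a) (c := c + 1) ha hc.add_one (by rw [e1]; exact hcμ.add_one) hn'
    have h3 := (h1.add h2 (a / c) ((c - a) / c)).congr (g := fun y => w₁ y a b c)
      measurableSet_Iio fun y hy => (w₁_contiguous a b hc (lt_trans hy hx)).symm
    convert h3 using 1
    have a0 : a ≠ 0 := (notPole_of_re_pos (hμ.trans ha)).ne_zero
    have haμ : 0 < (a - μ).re := by simpa using ha
    have aμ0 : a - μ ≠ 0 := (notPole_of_re_pos haμ).ne_zero
    have c0 := hc.ne_zero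
    have cμ0 := hcμ.ne_zero
    -- The Gamma quotients turn the coefficients `a/c` and `(c-a)/c` into those of the contiguous
    -- relation at `(a-μ, b-μ, c-μ)`.
    rw [w₁_contiguous (a - μ) (b - μ) hcμ hx, e1, e2, Complex.Gamma_add_one _ a0,
      Complex.Gamma_add_one _ aμ0, Complex.Gamma_add_one _ c0, Complex.Gamma_add_one _ cμ0]
    have g1 := Complex.Gamma_ne_zero hc
    have g2 := Complex.Gamma_ne_zero hcμ
    have g3 := Complex.Gamma_ne_zero_of_re_pos haμ
    have g4 := Complex.Gamma_ne_zero_of_re_pos (hμ.trans ha)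
    have g5 := Complex.Gamma_ne_zero_of_re_pos (hμ.trans hb)
    field_simp
    ring

theorem hasFracInt_cM {a b c μ : ℂ} {x : ℝ} (hμ : 0 < μ.re) (ha : μ.re < (c - a).re)
    (hb : μ.re < (c - b).re) (hc : NotPole c) (hcμ : NotPole (c - μ)) (hx : x < 1) :
    HasFracInt (Set.Iio x) (fun y => absPow (1 - y) (a + b - c) * w₁ y a b c) μ x
      (Complex.Gamma (c - a - μ) / Complex.Gamma (c - a) *
        (Complex.Gamma (c - b - μ) / Complex.Gamma (c - b)) *
        (Complex.Gamma c / Complex.Gamma (c - μ)) *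
        (absPow (1 - x) (a + b - c + μ) * w₁ x a b (c - μ))) := by
  have h := absPow_mul_w₁_euler a b hcμ hx
  rw [show a + b - (c - μ) = a + b - c + μ by ring, sub_right_comm, sub_right_comm c μ b] at h
  rw [h]
  exact (hasFracInt_aMbMcM hμ ha hb hc hcμ hx).congr measurableSet_Iio fun y hy =>
    (absPow_mul_w₁_euler a b hc (lt_trans hy hx)).symm

/-- Type `a-,b-,c-` at `(a, c-b, c)`, transported by Pfaff's transformation. The decreasing map `y ↦
y/(y-1)` takes `(x,1)` onto the half-line below `x/(x-1)`. -/
theorem hasFracInt_aMcM {a b c μ : ℂ} {x : ℝ} (hμ : 0 < μ.re) (ha : μ.re < a.re)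
    (hb : μ.re < (c - b).re) (hc : NotPole c) (hcμ : NotPole (c - μ)) (hx : x < 1) :
    HasFracInt (Set.Ioo x 1) (fun y => absPow (1 - y) (a - μ - 1) * w₁ y a b c) μ x
      (Complex.Gamma (a - μ) / Complex.Gamma a *
        (Complex.Gamma (c - b - μ) / Complex.Gamma (c - b)) *
        (Complex.Gamma c / Complex.Gamma (c - μ)) *
        (absPow (1 - x) (a - 1) * w₁ x (a - μ) b (c - μ))) := by
  have h := HasFracInt.pfaff hx (P := Set.Ioo x 1)
    (g := fun y => absPow (1 - y) (a - μ - 1) * w₁ y a b c)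
    (hasFracInt_aMbMcM hμ ha hb hc hcμ (div_sub_one_lt_one hx))
    (fun y hy => hy.2) measurableSet_Ioo ?_ ?_
  · convert h using 1
    have h1 : 1 - x ≠ 0 := by linarith
    rw [w₁_pfaff (a - μ) b hcμ hx, sub_right_comm c μ b, show a - 1 = a - μ + (μ - 1) by ring,
      absPow_add h1, absPow_neg]
    have := absPow_ne_zero h1 (a - μ)
    field_simp
  · refine image_div_sub_one (fun y hy => hy.2)
      (fun y hy => lt_trans hy (div_sub_one_lt_one hx)) fun y hy => ?_
    rw [Set.mem_Iio, div_sub_one_lt_iff hy hx, Set.mem_Ioo]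
    exact and_iff_left hy
  · intro y hy
    have h1 : 1 - y ≠ 0 := by linarith [hy.2]
    rw [w₁_pfaff a b hc hy.2, show a - μ - 1 = a + (-μ - 1) by ring, absPow_add h1, absPow_neg]
    have := absPow_ne_zero h1 a
    field_simp

theorem hasFracInt_w₁ {T : Kind} {p : Par} {μ : ℂ} (h : T.cond₁ μ p) (hc : NotPole p.c)
    (hc' : NotPole (T.shift μ p).c) {x : ℝ} (hx : x ∈ T.dom₁) :
    HasFracInt (T.reg₁ x) (fun y => T.wt μ p y * w₁ y p.a p.b p.c) μ x
      (T.const₁ μ p * (T.vt μ p x *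
        w₁ x (T.shift μ p).a (T.shift μ p).b (T.shift μ p).c)) := by
  cases T
  · exact hasFracInt_cP _ _ h.1 h.2 hx.1 hx.2
  · exact hasFracInt_aPcP _ _ h.1 h.2 hx.1 hx.2
  · exact hasFracInt_aPbPcP _ _ h.1 h.2 hx.1 hx.2
  · exact hasFracInt_aM _ hc h.1 h.2 hx.1 hx.2
  · exact hasFracInt_aP _ _ hc h.1 h.2 hx.1 hx.2
  · simp only [Kind.wt, Kind.vt, one_mul]
    exact hasFracInt_aMbMcM h.1 h.2.1 h.2.2 hc hc' hx
  · exact hasFracInt_aMcM h.1 h.2.1 h.2.2 hc hc' hx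
  · exact hasFracInt_cM h.1 h.2.1 h.2.2 hc hc' hx

/-! ### Reduction of the six solutions to the first -/

/-- The power factor in each solution. -/
def Sol.pref (x : ℝ) (p : Par) : Sol → ℂ
  | .s₁ | .s₅ => 1
  | .s₂ => absPow x (1 - p.c)
  | .s₃ => absPow x (-p.a)
  | .s₄ => absPow x (-p.b)
  | .s₆ => absPow (1 - x) (p.c - p.a - p.b)

theorem Kind.redPar_eq (p : Par) (T : Kind) (j : Sol) :
    T.redPar p j = j.par p ∨ T.redPar p j = (j.par p).swap := by
  cases T <;> cases j <;> first | exact Or.inl rfl | exact Or.inr rfl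

theorem Kind.redPar_c (p : Par) (T : Kind) (j : Sol) : (T.redPar p j).c = (j.par p).c := by
  rcases T.redPar_eq p j with h | h <;> rw [h]
  rfl

/-- The hypergeometric factor of a solution, in terms of the first solution. -/
theorem Sol.w_eq (x : ℝ) (p : Par) (T : Kind) (j : Sol) :
    j.w x p = j.pref x p * Sol.s₁.w (j.arg x) (T.redPar p j) := by
  have h : Sol.s₁.w (j.arg x) (T.redPar p j) = Sol.s₁.w (j.arg x) (j.par p) := by
    rcases T.redPar_eq p j with h | h <;> rw [h]
    exact w₁_symm _ _ _ _
  rw [h]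
  cases j <;> simp [Sol.w, Sol.pref, w₁, w₂, w₃, w₄, w₅, w₆, Sol.arg, Sol.par]

theorem Kind.redPar_shift (μ : ℂ) (p : Par) (T : Kind) (j : Sol) :
    T.redPar (T.shift μ p) j = (T.table j).shift μ (T.redPar p j) := by
  cases T <;> cases j <;> refine Par.ext ?_ ?_ ?_ <;>
    simp only [Kind.redPar, Kind.shift, Kind.table, Sol.par, Par.swap] <;> ring

/-- The derivative of the argument function. -/
def Sol.argDeriv (y : ℝ) : Sol → ℝ
  | .s₁ | .s₂ => 1
  | .s₃ | .s₄ => -(y ^ 2)⁻¹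
  | .s₅ | .s₆ => -1

theorem Sol.hasDerivAt_arg (j : Sol) {y : ℝ} (hy : y ∉ j.excl) :
    HasDerivAt (fun t => j.arg t) (j.argDeriv y) y := by
  cases j
  · exact hasDerivAt_id y
  · exact hasDerivAt_id y
  · exact hasDerivAt_inv hy
  · exact hasDerivAt_inv hy
  · exact (hasDerivAt_id y).const_sub 1
  · exact (hasDerivAt_id y).const_sub 1

theorem one_sub_inv_eq {y : ℝ} (hy : y ≠ 0) : 1 - y⁻¹ = -((1 - y) / y) := by field_simp; ring

theorem inv_sub_inv_eq {x y : ℝ} (hx : x ≠ 0) (hy : y ≠ 0) : x⁻¹ - y⁻¹ = -((x - y) / (x * y)) := by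
  field_simp; ring

/-- Without the hypergeometric factor, the equality of integrands is an identity between powers of
`|x|`, `|y|`, `|1-y|` and `|x-y|`. Splitting the exponents makes each of the 48 table entries a
rational identity in the basic powers. -/
theorem Kind.wt_mul_pref (μ : ℂ) (p : Par) (T : Kind) (j : Sol) {x y : ℝ} (hx : x ∉ j.excl)
    (hy0 : y ≠ 0) (hy1 : y ≠ 1) :
    T.wt μ p y * j.pref y p * absPow (x - y) (μ - 1) =
      j.factor μ x * (((|j.argDeriv y| : ℝ) : ℂ) * ((T.table j).wt μ (T.redPar p j) (j.arg y) *
        absPow (j.arg x - j.arg y) (μ - 1))) := by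
  have hy1' : 1 - y ≠ 0 := sub_ne_zero.2 hy1.symm
  obtain ⟨a, b, c⟩ := p
  have ya := absPow_ne_zero hy0 a
  have yb := absPow_ne_zero hy0 b
  have yc := absPow_ne_zero hy0 c
  have yμ := absPow_ne_zero hy0 μ
  have y1 := absPow_ne_zero hy0 1
  have za := absPow_ne_zero hy1' a
  have zb := absPow_ne_zero hy1' b
  have zc := absPow_ne_zero hy1' c
  have zμ := absPow_ne_zero hy1' μ
  have z1 := absPow_ne_zero hy1' 1
  have e2 : ∀ {u : ℝ}, u ≠ 0 → absPow u 2 = absPow u 1 * absPow u 1 := fun hu => by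
    rw [← absPow_add hu]; norm_num
  have hd : (((|(-(y ^ 2)⁻¹ : ℝ)| : ℝ)) : ℂ) = (absPow y 1 * absPow y 1)⁻¹ := by
    rw [← e2 hy0, absPow_two, abs_neg, abs_inv, abs_pow, Complex.ofReal_inv, Complex.ofReal_pow]
  cases j
  case s₃ | s₄ =>
    have hx0 : x ≠ 0 := hx
    have xμ := absPow_ne_zero hx0 μ
    have x1 := absPow_ne_zero hx0 1
    cases T <;>
    (simp only [Sol.pref, Sol.argDeriv, Sol.arg, Sol.factor, Sol.par, Kind.wt, Kind.redPar,
        Kind.table, Par.swap, hd]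
     simp only [one_sub_inv_eq hy0, inv_sub_inv_eq hx0 hy0, absPow_neg_left, absPow_div, absPow_mul,
       absPow_inv]
     generalize absPow (x - y) (μ - 1) = D
     simp only [absPow_sub hy0, absPow_add hy0, absPow_neg, absPow_sub hy1', absPow_add hy1',
       absPow_sub hx0]
     field_simp)
  case s₁ | s₂ | s₅ | s₆ =>
    cases T <;>
    (simp only [Sol.pref, Sol.argDeriv, Sol.arg, Sol.factor, Sol.par, Kind.wt, Kind.redPar,
        Kind.table, Par.swap, sub_sub_cancel, sub_sub_sub_cancel_left, absPow_sub_comm y x,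
        abs_neg, abs_one, Complex.ofReal_one]
     generalize absPow (x - y) (μ - 1) = D
     try simp only [absPow_sub hy0, absPow_add hy0, absPow_sub hy1', absPow_add hy1', e2 hy0,
       e2 hy1']
     try field_simp)

theorem Kind.vt_mul_pref (μ : ℂ) (p : Par) (T : Kind) (j : Sol) {x : ℝ} (hx0 : x ≠ 0)
    (hx1 : x ≠ 1) :
    T.vt μ p x * j.pref x (T.shift μ p) =
      j.factor μ x * (T.table j).vt μ (T.redPar p j) (j.arg x) := by
  have hx1' : 1 - x ≠ 0 := sub_ne_zero.2 hx1.symm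
  obtain ⟨a, b, c⟩ := p
  have ya := absPow_ne_zero hx0 a
  have yb := absPow_ne_zero hx0 b
  have yc := absPow_ne_zero hx0 c
  have yμ := absPow_ne_zero hx0 μ
  have y1 := absPow_ne_zero hx0 1
  have za := absPow_ne_zero hx1' a
  have zb := absPow_ne_zero hx1' b
  have zc := absPow_ne_zero hx1' c
  have zμ := absPow_ne_zero hx1' μ
  have z1 := absPow_ne_zero hx1' 1
  have e2 : ∀ {u : ℝ}, u ≠ 0 → absPow u 2 = absPow u 1 * absPow u 1 := fun hu => by
    rw [← absPow_add hu]; norm_num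
  cases j <;> cases T <;>
    (simp only [Sol.pref, Sol.arg, Sol.factor, Sol.par, Kind.vt, Kind.redPar, Kind.shift,
        Kind.table, Par.swap, one_sub_inv_eq hx0, absPow_neg_left, absPow_div, absPow_inv,
        sub_sub_cancel]
     try simp only [absPow_sub hx0, absPow_add hx0, absPow_neg, absPow_sub hx1', absPow_add hx1',
       e2 hx0, e2 hx1']
     try field_simp)

theorem Sol.integrand_eq (μ : ℂ) (p : Par) (T : Kind) (j : Sol) {x y : ℝ} (hx : x ∉ j.excl)
    (hy0 : y ≠ 0) (hy1 : y ≠ 1) :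
    T.wt μ p y * j.w y p * absPow (x - y) (μ - 1) =
      j.factor μ x * (((|j.argDeriv y| : ℝ) : ℂ) *
        ((T.table j).wt μ (T.redPar p j) (j.arg y) * Sol.s₁.w (j.arg y) (T.redPar p j) *
          absPow (j.arg x - j.arg y) (μ - 1))) := by
  have h := T.wt_mul_pref μ p j hx hy0 hy1
  rw [j.w_eq y p T]
  linear_combination (Sol.s₁.w (j.arg y) (T.redPar p j)) * h

theorem Sol.rhs_eq (μ : ℂ) (p : Par) (T : Kind) (j : Sol) {x : ℝ} (hx0 : x ≠ 0) (hx1 : x ≠ 1) :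
    T.vt μ p x * j.w x (T.shift μ p) =
      j.factor μ x * ((T.table j).vt μ (T.redPar p j) (j.arg x) *
        Sol.s₁.w (j.arg x) ((T.table j).shift μ (T.redPar p j))) := by
  have h := T.vt_mul_pref μ p j hx0 hx1
  rw [j.w_eq x _ T, T.redPar_shift]
  linear_combination (Sol.s₁.w (j.arg x) ((T.table j).shift μ (T.redPar p j))) * h

theorem Sol.notMem_excl {j : Sol} {y : ℝ} (hy : y ≠ 0) : y ∉ j.excl := by
  cases j <;> simp [Sol.excl, hy]

theorem reduces (μ : ℂ) (p : Par) (T : Kind) (j : Sol) : Reduces μ p T j := by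
  refine ⟨T.redPar_shift μ p j, fun x y hx0 _ hy0 hy1 => ?_, fun x hx0 hx1 =>
    j.rhs_eq μ p T hx0 hx1⟩
  rw [(j.hasDerivAt_arg (Sol.notMem_excl hy0)).deriv]
  exact j.integrand_eq μ p T (Sol.notMem_excl hx0) hy0 hy1

theorem Sol.arg_arg (j : Sol) (y : ℝ) : j.arg (j.arg y) = y := by
  cases j <;> simp [Sol.arg]

theorem Sol.measurable_arg (j : Sol) : Measurable fun y => j.arg y := by
  cases j <;> (simp only [Sol.arg]; fun_prop)

theorem Kind.measurableSet_reg₁ (T : Kind) (x : ℝ) : MeasurableSet (T.reg₁ x) := by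
  cases T
  · exact measurableSet_between x
  · exact measurableSet_between x
  · exact measurableSet_between x
  · exact measurableSet_between x
  · exact measurableSet_between x
  · exact measurableSet_Iio
  · exact measurableSet_Ioo
  · exact measurableSet_Iio

theorem ae_eq_diff_of_finite {S F : Set ℝ} (hF : F.Finite) : (S \ F : Set ℝ) =ᵐ[volume] S :=
  sdiff_null_ae_eq_self (hF.measure_zero volume)

/-- The formula of type `T` for the solution `j`, with the right-hand side in terms of the first
solution. -/
theorem hasFracInt_reduced {T : Kind} {j : Sol} {p : Par} {μ : ℂ} (h : T.cond μ p j) {x : ℝ}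
    (hx : x ∈ T.dom j) :
    HasFracInt (T.reg j x) (fun y => T.wt μ p y * j.w y p) μ x
      (j.factor μ x * (T.const μ p j * ((T.table j).vt μ (T.redPar p j) (j.arg x) *
        Sol.s₁.w (j.arg x) ((T.table j).shift μ (T.redPar p j))))) := by
  obtain ⟨h1, h2, h3⟩ := h
  rw [← T.redPar_c] at h2
  rw [← T.redPar_c, T.redPar_shift] at h3
  have hbase := hasFracInt_w₁ h1 h2 h3 hx.2
  -- The pointwise identity of integrands is available only off `0` and `1`; these points and their
  -- images are null sets and are removed from both integrals.
  set F : Set ℝ := {0, 1} with hF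
  have hFfin : F.Finite := Set.toFinite _
  set S : Set ℝ := (fun y => j.arg y) ⁻¹' ((T.table j).reg₁ (j.arg x)) \ F with hS
  have hSm : MeasurableSet S := (j.measurable_arg ((T.table j).measurableSet_reg₁ _)).diff
    hFfin.measurableSet
  have hbase' := hbase.congr_set (ae_eq_diff_of_finite (hFfin.image (fun y => j.arg y))).symm
  have hSmem : ∀ y ∈ S, y ≠ 0 ∧ y ≠ 1 := fun y hy => by
    have : y ∉ F := hy.2
    simpa [hF] using this
  have hkey := hbase'.changeVar (S := S) (φ := fun y => j.arg y) (φ' := fun y => j.argDeriv y)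
    (g := fun y => T.wt μ p y * j.w y p) (x := x) (A := j.factor μ x) hSm
    (fun y hy => j.hasDerivAt_arg (Sol.notMem_excl (hSmem y hy).1))
    (Function.LeftInverse.injective (g := fun y => j.arg y) j.arg_arg).injOn ?_
    (fun y hy => j.integrand_eq μ p T hx.1 (hSmem y hy).1 (hSmem y hy).2)
  · refine hkey.congr_set ?_
    have e : S = T.reg j x \ F := by
      ext y
      constructor
      · intro hy
        exact ⟨⟨Sol.notMem_excl (hSmem y hy).1, hy.1⟩, hy.2⟩
      · intro hy
        exact ⟨hy.1.2, hy.2⟩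
    rw [e]
    exact ae_eq_diff_of_finite hFfin
  · ext t
    constructor
    · rintro ⟨y, hy, rfl⟩
      refine ⟨hy.1, ?_⟩
      rintro ⟨z, hz, hzy⟩
      have hzy' : j.arg z = j.arg y := hzy
      have : z = y := by rw [← j.arg_arg y, ← hzy', j.arg_arg]
      exact hy.2 (this ▸ hz)
    · rintro ⟨h4, h5⟩
      refine ⟨j.arg t, ⟨?_, fun h6 => h5 ⟨j.arg t, h6, j.arg_arg t⟩⟩, j.arg_arg t⟩
      rw [Set.mem_preimage, j.arg_arg]
      exact h4

/-! ### Endpoints and removable singularities -/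

theorem Kind.dom₁_lt {T : Kind} {x : ℝ} (hx : x ∈ T.dom₁) : x < 1 := by
  cases T <;> first | exact hx.1 | exact hx

/-- The only points `0`, `1` left to treat are `x = 0` for `w₁`, where both sides are the same
expression, and `x = 1` for `w₅`, where the surviving weights equal `1`. -/
theorem Sol.rhs_eq_of_notMem_sing (μ : ℂ) (p : Par) (T : Kind) (j : Sol) {x : ℝ}
    (hx : x ∈ T.dom j) (hs : x ∉ j.sing) :
    T.vt μ p x * j.w x (T.shift μ p) =
      j.factor μ x * ((T.table j).vt μ (T.redPar p j) (j.arg x) *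
        Sol.s₁.w (j.arg x) ((T.table j).shift μ (T.redPar p j))) := by
  have hlt := Kind.dom₁_lt hx.2
  cases j
  case s₁ => cases T <;> exact (one_mul _).symm
  case s₅ =>
    rw [Sol.s₅.w_eq x _ T, T.redPar_shift]
    have h0 : x ≠ 0 := by rintro rfl; simp [Sol.arg] at hlt
    by_cases h1 : x = 1
    · subst h1
      have hd := hx.2
      cases T <;> simp [Sol.arg, Kind.table, Kind.dom₁, Kind.vt, Sol.pref, Sol.factor] at hd ⊢ <;>
        simp [one_absPow]
    · have h := T.vt_mul_pref μ p .s₅ h0 h1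
      rw [← mul_assoc, h]
      ring
  case s₂ =>
    exact Sol.rhs_eq μ p T _ hs (by rintro rfl; simp [Sol.arg] at hlt)
  case s₃ =>
    exact Sol.rhs_eq μ p T _ hx.1 (by rintro rfl; simp [Sol.arg] at hlt)
  case s₄ =>
    exact Sol.rhs_eq μ p T _ hx.1 (by rintro rfl; simp [Sol.arg] at hlt)
  case s₆ =>
    exact Sol.rhs_eq μ p T _ (by rintro rfl; simp [Sol.arg] at hlt) hs

theorem continuousAt_absPow {f : ℝ → ℝ} {x : ℝ} (hf : ContinuousAt f x) (hx : f x ≠ 0) (s : ℂ) :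
    ContinuousAt (fun t => absPow (f t) s) x := by
  unfold absPow
  refine ContinuousAt.cpow (by fun_prop) continuousAt_const (Or.inl ?_)
  simpa using hx

/-- If `0` belongs to the range, the type is one of the last three, whose weight contains no power
of `|x|`. -/
theorem Kind.continuousAt_vt_mul_w {T : Kind} {p q : Par} {μ : ℂ} (hq : NotPole q.c)
    (h0 : (0 : ℝ) ∈ T.dom₁) :
    ContinuousAt (fun t => T.vt μ p t * Sol.s₁.w t q) 0 := by
  refine ContinuousAt.mul ?_ ?_
  · have h1 : ∀ s, ContinuousAt (fun t : ℝ => absPow (1 - t) s) 0 := fun s =>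
      continuousAt_absPow (by fun_prop) (by simp) s
    cases T
    case aMbMcM => exact continuousAt_const
    case aMcM => exact h1 _
    case cM => exact h1 _
    all_goals exact absurd rfl h0.2
  · exact (continuousOn_gaussF q.a q.b hq).continuousAt (Iio_mem_nhds one_pos)

theorem hasFracInt_main {T : Kind} {j : Sol} {p : Par} {μ : ℂ} (h : T.cond μ p j) {x : ℝ}
    (hx : x ∈ T.dom j) :
    (x ∉ j.sing → HasFracInt (T.reg j x) (fun y => T.wt μ p y * j.w y p) μ x (T.rhs μ p j x)) ∧
    (x ∈ j.sing →
      HasFracIntLim (T.reg j x) (fun y => T.wt μ p y * j.w y p) μ x (T.rhs μ p j)) := by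
  have hred := hasFracInt_reduced h hx
  constructor
  · intro hs
    rw [Kind.rhs, j.rhs_eq_of_notMem_sing μ p T hx hs, mul_left_comm]
    exact hred
  · intro hs
    -- At a singular point the argument is `0`. The reduced right side is continuous there and
    -- agrees with the stated one at nearby points, so its value is the limit.
    refine ⟨_, hred, ?_⟩
    have h3 := h.2.2
    rw [← T.redPar_c, T.redPar_shift] at h3
    have harg : j.arg x = 0 ∧ ContinuousAt (fun t => j.arg t) x ∧ ∀ t, j.factor μ t = 1 := by
      cases j
      case s₂ => exact ⟨hs, continuousAt_id, fun _ => rfl⟩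
      case s₆ =>
        have : x = 1 := hs
        refine ⟨by simp [Sol.arg, this], ?_, fun _ => rfl⟩
        simp only [Sol.arg]; fun_prop
      all_goals exact absurd hs (Set.notMem_empty x)
    obtain ⟨ha, hc, hf⟩ := harg
    have hd := hx.2
    rw [ha] at hd
    have hcont := Kind.continuousAt_vt_mul_w (p := T.redPar p j) (μ := μ) h3 hd
    rw [← ha] at hcont
    have hlim := Tendsto.const_mul (T.const μ p j)
      (ContinuousAt.comp (f := fun t => j.arg t) hcont hc).tendsto
    have hlim' := hlim.mono_left (nhdsWithin_le_nhds (s := {x}ᶜ))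
    rw [hf, one_mul]
    refine hlim'.congr' ?_
    have e0 : ∀ᶠ t in 𝓝[≠] x, t ≠ 0 := by
      by_cases hx0 : x = 0
      · subst hx0; exact self_mem_nhdsWithin
      · exact mem_nhdsWithin_of_mem_nhds (isOpen_ne.mem_nhds hx0)
    have e1 : ∀ᶠ t in 𝓝[≠] x, t ≠ 1 := by
      by_cases hx1 : x = 1
      · subst hx1; exact self_mem_nhdsWithin
      · exact mem_nhdsWithin_of_mem_nhds (isOpen_ne.mem_nhds hx1)
    filter_upwards [e0, e1] with t ht0 ht1
    rw [Kind.rhs, j.rhs_eq μ p T ht0 ht1, hf, one_mul]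
    rfl

/-! ### The explicit formulas as instances of the general one -/

theorem reg_inv_between {x : ℝ} :
    {y : ℝ | y ∉ ({0} : Set ℝ) ∧ y⁻¹ ∈ {z : ℝ | 0 < z / x⁻¹ ∧ z / x⁻¹ < 1}} =
      {y : ℝ | 1 < y / x} := by
  ext y
  simp only [Set.mem_ofPred_eq, Set.mem_singleton_iff]
  have e : y⁻¹ / x⁻¹ = (y / x)⁻¹ := by rw [inv_div_inv, inv_div]
  rw [e, inv_pos]
  constructor
  · rintro ⟨-, h1, h2⟩
    exact (inv_lt_one_iff₀.1 h2).resolve_left h1.not_ge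
  · intro h
    refine ⟨?_, by linarith, inv_lt_one_of_one_lt₀ h⟩
    rintro rfl
    norm_num at h

theorem inv_mem_dom₁ {x : ℝ} (hx : x < 0 ∨ 1 < x) : x ≠ 0 ∧ x⁻¹ < 1 ∧ x⁻¹ ≠ 0 := by
  have h0 : x ≠ 0 := by rintro rfl; norm_num at hx
  refine ⟨h0, ?_, inv_ne_zero h0⟩
  rcases hx with h | h
  · exact (inv_lt_zero.2 h).trans one_pos
  · exact inv_lt_one_of_one_lt₀ h

theorem reg_one_sub_Iio (x : ℝ) :
    {y : ℝ | y ∉ (∅ : Set ℝ) ∧ 1 - y ∈ Set.Iio (1 - x)} = Set.Ioi x := by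
  ext y; simp

theorem notPole_congr {a b : ℂ} (h : NotPole a) (e : a = b) : NotPole b := e ▸ h

theorem setOf_notMem_empty_and {P : Set ℝ} :
    {y : ℝ | y ∉ (∅ : Set ℝ) ∧ y ∈ P} = P := by
  ext y; simp

end

end FracHyp

open Complex in
theorem mainTheorem4 :
    -- the six formulas of type `c+`
    (∀ (a b c μ : ℂ) (x : ℝ), 0 < c.re → 0 < μ.re → x < 1 → x ≠ 0 →
      HasFracInt {y | 0 < y / x ∧ y / x < 1} (fun y => absPow y (c - 1) * w₁ y a b c) μ x
        (Gamma c / Gamma (c + μ) * (absPow x (c + μ - 1) * w₁ x a b (c + μ)))) ∧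
    (∀ (a b c μ : ℂ) (x : ℝ), 0 < μ.re → μ.re < (a - c + 1).re → μ.re < (b - c + 1).re →
      NotPole (2 - c) → NotPole (2 - c - μ) → x < 1 →
      (x ≠ 0 → HasFracInt (Set.Iio x) (fun y => absPow y (c - 1) * w₂ y a b c) μ x
        (Gamma (a - c - μ + 1) / Gamma (a - c + 1) * (Gamma (b - c - μ + 1) / Gamma (b - c + 1)) *
          (Gamma (2 - c) / Gamma (2 - c - μ)) *
          (absPow x (c + μ - 1) * w₂ x a b (c + μ)))) ∧
      (x = 0 → HasFracIntLim (Set.Iio x) (fun y => absPow y (c - 1) * w₂ y a b c) μ x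
        (fun t => Gamma (a - c - μ + 1) / Gamma (a - c + 1) * (Gamma (b - c - μ + 1) / Gamma (b - c + 1)) *
          (Gamma (2 - c) / Gamma (2 - c - μ)) *
          (absPow t (c + μ - 1) * w₂ t a b (c + μ))))) ∧
    (∀ (a b c μ : ℂ) (x : ℝ), 0 < μ.re → μ.re < (a - c + 1).re →
      NotPole (a - b + 1) → (x < 0 ∨ 1 < x) →
      HasFracInt {y | 1 < y / x} (fun y => absPow y (c - 1) * w₃ y a b c) μ x
        (Gamma (a - c - μ + 1) / Gamma (a - c + 1) *
          (absPow x (c + μ - 1) * w₃ x a b (c + μ)))) ∧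
    (∀ (a b c μ : ℂ) (x : ℝ), 0 < μ.re → μ.re < (b - c + 1).re →
      NotPole (b - a + 1) → (x < 0 ∨ 1 < x) →
      HasFracInt {y | 1 < y / x} (fun y => absPow y (c - 1) * w₄ y a b c) μ x
        (Gamma (b - c - μ + 1) / Gamma (b - c + 1) *
          (absPow x (c + μ - 1) * w₄ x a b (c + μ)))) ∧
    (∀ (a b c μ : ℂ) (x : ℝ), 0 < μ.re → μ.re < (a - c + 1).re → μ.re < (b - c + 1).re →
      NotPole (a + b - c + 1) → NotPole (a + b - c - μ + 1) → 0 < x →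
      HasFracInt (Set.Ioi x) (fun y => absPow y (c - 1) * w₅ y a b c) μ x
        (Gamma (b - c - μ + 1) / Gamma (b - c + 1) * (Gamma (a - c - μ + 1) / Gamma (a - c + 1)) *
          (Gamma (a + b - c + 1) / Gamma (a + b - c - μ + 1)) *
          (absPow x (c + μ - 1) * w₅ x a b (c + μ)))) ∧
    (∀ (a b c μ : ℂ) (x : ℝ), 0 < (c - a - b + 1).re → 0 < μ.re → 0 < x → x ≠ 1 →
      HasFracInt {y | 0 < (1 - y) / (1 - x) ∧ (1 - y) / (1 - x) < 1}
        (fun y => absPow y (c - 1) * w₆ y a b c) μ x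
        (Gamma (c - a - b + 1) / Gamma (c - a - b + μ + 1) *
          (absPow x (c + μ - 1) * w₆ x a b (c + μ)))) ∧
    -- three formulas of other types
    (∀ (a b c μ : ℂ) (x : ℝ), 0 < μ.re → μ.re < (a - c + 1).re →
      NotPole (2 - c) → x < 1 → x ≠ 0 →
      HasFracInt {y | 0 < y / x ∧ y / x < 1} (fun y => absPow y (a - μ - 1) * w₂ y a b c) μ x
        (Gamma (a - c - μ + 1) / Gamma (a - c + 1) *
          (absPow x (a - 1) * w₂ x (a - μ) b c))) ∧
    (∀ (a b c μ : ℂ) (x : ℝ), 0 < μ.re → μ.re < b.re →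
      NotPole (b - a + 1) → (x < 0 ∨ 1 < x) →
      HasFracInt {y | 1 < y / x} (fun y => w₄ y a b c) μ x
        (Gamma (b - μ) / Gamma b * w₄ x (a - μ) (b - μ) (c - μ))) ∧
    (∀ (a b c μ : ℂ) (x : ℝ), 0 < (c - a - b + 1).re → 0 < μ.re → 0 < x → x ≠ 1 →
      HasFracInt {y | 0 < (1 - y) / (1 - x) ∧ (1 - y) / (1 - x) < 1}
        (fun y => w₆ y a b c) μ x
        (Gamma (c - a - b + 1) / Gamma (c - a - b + μ + 1) *
          w₆ x (a - μ) (b - μ) (c - μ))) ∧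
    -- all eight types for all six solutions, with the reductions given by the table
    (∀ (T : Kind) (j : Sol) (p : Par) (μ : ℂ),
      Reduces μ p T j ∧
      (T.cond μ p j → ∀ x ∈ T.dom j,
        (x ∉ j.sing →
          HasFracInt (T.reg j x) (fun y => T.wt μ p y * j.w y p) μ x (T.rhs μ p j x)) ∧
        (x ∈ j.sing →
          HasFracIntLim (T.reg j x) (fun y => T.wt μ p y * j.w y p) μ x (T.rhs μ p j)))) := by
  refine ⟨?_, ?_, ?_, ?_, ?_, ?_, ?_, ?_, ?_, fun T j p μ =>
    ⟨reduces μ p T j, fun h x hx => hasFracInt_main h hx⟩⟩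
  · intro a b c μ x hc hμ hx hx0
    exact hasFracInt_cP a b hc hμ hx hx0
  · intro a b c μ x hμ ha hb hc hc' hx
    have h := hasFracInt_main (T := .cP) (j := .s₂) (p := ⟨a, b, c⟩) (μ := μ) (x := x)
      ⟨⟨hμ, ha, hb⟩, hc, notPole_congr hc' (by simp only [Sol.par, Kind.shift]; ring)⟩
      ⟨Set.notMem_empty x, hx⟩
    have hreg : Kind.reg .cP .s₂ x = Set.Iio x := setOf_notMem_empty_and
    have hrhs : Kind.rhs μ ⟨a, b, c⟩ .cP .s₂ = fun t =>
        Gamma (a - c - μ + 1) / Gamma (a - c + 1) * (Gamma (b - c - μ + 1) / Gamma (b - c + 1)) *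
          (Gamma (2 - c) / Gamma (2 - c - μ)) *
          (absPow t (c + μ - 1) * w₂ t a b (c + μ)) := by
      rw [show a - c - μ + 1 = a - c + 1 - μ by ring, show b - c - μ + 1 = b - c + 1 - μ by ring]
      rfl
    rw [hreg, hrhs] at h
    exact h
  · intro a b c μ x hμ ha hc hx
    have h := (hasFracInt_main (T := .cP) (j := .s₃) (p := ⟨a, b, c⟩) (μ := μ) (x := x)
      ⟨⟨hμ, ha⟩, hc, hc⟩ (inv_mem_dom₁ hx)).1 (Set.notMem_empty x)
    rw [show a - c - μ + 1 = a - c + 1 - μ by ring, ← reg_inv_between]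
    exact h
  · intro a b c μ x hμ hb hc hx
    have h := (hasFracInt_main (T := .cP) (j := .s₄) (p := ⟨a, b, c⟩) (μ := μ) (x := x)
      ⟨⟨hμ, hb⟩, hc, hc⟩ (inv_mem_dom₁ hx)).1 (Set.notMem_empty x)
    rw [show b - c - μ + 1 = b - c + 1 - μ by ring, ← reg_inv_between]
    exact h
  · intro a b c μ x hμ ha hb hc hc' hx
    -- Here the type is `c-` at `(a, b, a+b-c+1)`, so `γ - α` and `γ - β` are `b - c + 1` and `a - c
    -- + 1`; the two conditions enter in exchanged order.
    have e1 : a + b - c + 1 - a = b - c + 1 := by ring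
    have e2 : a + b - c + 1 - b = a - c + 1 := by ring
    have h := (hasFracInt_main (T := .cP) (j := .s₅) (p := ⟨a, b, c⟩) (μ := μ) (x := x)
      ⟨⟨hμ, by simpa only [Kind.redPar, Sol.par, e1] using hb,
        by simpa only [Kind.redPar, Sol.par, e2] using ha⟩, hc,
        notPole_congr hc' (by simp only [Sol.par, Kind.shift]; ring)⟩
      ⟨Set.notMem_empty x, show 1 - x < 1 by linarith⟩).1 (Set.notMem_empty x)
    have hreg : Kind.reg .cP .s₅ x = Set.Ioi x := reg_one_sub_Iio x
    have hrhs : Kind.rhs μ ⟨a, b, c⟩ .cP .s₅ x =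
        Gamma (a + b - c + 1 - a - μ) / Gamma (a + b - c + 1 - a) *
          (Gamma (a + b - c + 1 - b - μ) / Gamma (a + b - c + 1 - b)) *
          (Gamma (a + b - c + 1) / Gamma (a + b - c + 1 - μ)) *
          (absPow x (c + μ - 1) * w₅ x a b (c + μ)) := rfl
    rw [hreg, hrhs, e1, e2] at h
    rw [show b - c - μ + 1 = b - c + 1 - μ by ring, show a - c - μ + 1 = a - c + 1 - μ by ring,
      show a + b - c - μ + 1 = a + b - c + 1 - μ by ring]
    exact h
  · intro a b c μ x hc hμ hx hx1
    have h := (hasFracInt_main (T := .cP) (j := .s₆) (p := ⟨a, b, c⟩) (μ := μ) (x := x)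
      ⟨⟨hc, hμ⟩, notPole_of_re_pos hc, notPole_of_re_pos (by
          simp only [Sol.par, Kind.shift, add_re, sub_re, one_re] at hc ⊢; linarith)⟩
      ⟨Set.notMem_empty x, show 1 - x < 1 by linarith, sub_ne_zero.2 hx1.symm⟩).1 hx1
    have hreg : Kind.reg .cP .s₆ x = {y | 0 < (1 - y) / (1 - x) ∧ (1 - y) / (1 - x) < 1} :=
      setOf_notMem_empty_and
    rw [hreg] at h
    rw [show c - a - b + μ + 1 = c - a - b + 1 + μ by ring]
    exact h
  · intro a b c μ x hμ ha hc hx hx0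
    have h := (hasFracInt_main (T := .aM) (j := .s₂) (p := ⟨a, b, c⟩) (μ := μ) (x := x)
      ⟨⟨hμ, ha⟩, hc, hc⟩ ⟨Set.notMem_empty x, hx, hx0⟩).1 hx0
    have hreg : Kind.reg .aM .s₂ x = {y | 0 < y / x ∧ y / x < 1} := setOf_notMem_empty_and
    rw [hreg] at h
    rw [show a - c - μ + 1 = a - c + 1 - μ by ring]
    exact h
  · intro a b c μ x hμ hb hc hx
    -- Both upper parameters drop by `μ`, so `b - a + 1` is the same on both sides and one pole
    -- condition serves twice.
    have h := (hasFracInt_main (T := .aMbMcM) (j := .s₄) (p := ⟨a, b, c⟩) (μ := μ) (x := x)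
      ⟨⟨hμ, hb⟩, hc, notPole_congr hc (by simp only [Kind.shift, Sol.par]; ring)⟩
      (inv_mem_dom₁ hx)).1 (Set.notMem_empty x)
    simp only [Kind.wt, Kind.rhs, Kind.vt, one_mul] at h
    rw [← reg_inv_between]
    exact h
  · intro a b c μ x hc hμ hx hx1
    have h := (hasFracInt_main (T := .aMbMcM) (j := .s₆) (p := ⟨a, b, c⟩) (μ := μ) (x := x)
      ⟨⟨hc, hμ⟩, notPole_of_re_pos hc, notPole_of_re_pos (by
          simp only [Sol.par, Kind.shift, add_re, sub_re, one_re] at hc ⊢; linarith)⟩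
      ⟨Set.notMem_empty x, show 1 - x < 1 by linarith, sub_ne_zero.2 hx1.symm⟩).1 hx1
    have hreg : Kind.reg .aMbMcM .s₆ x = {y | 0 < (1 - y) / (1 - x) ∧ (1 - y) / (1 - x) < 1} :=
      setOf_notMem_empty_and
    rw [hreg] at h
    simp only [Kind.wt, Kind.rhs, Kind.vt, one_mul] at h
    rw [show c - a - b + μ + 1 = c - a - b + 1 + μ by ring]
    exact h
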